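/- For $n\ge 0$ let $Q_n$ be the hypercube graph on $\{0,1\}^n$, in which two binary sequences are adjacent if and only if they differ in exactly one coordinate. A $d$-subcube of $\{0,1\}^n$ is a subset $C\subseteq\{0,1\}^n$ such that the subgraph of $Q_n$ induced by $C$ is isomorphic to $Q_d$; for $n\ge d$ there are exactly $\binom nd 2^{n-d}$ of them. For $S\subseteq\{0,1\}^n$ and integers $d$ and $0\le s\le 2^d$, let $\Lambda(S,d,s)$ be the number of $d$-subcubes $C$ of $\{0,1\}^n$ with $|S\cap C|=s$, and for $n\ge d$ let $$\Lambda(n,d,s):=\max\{\Lambda(S,d,s) : S\subseteq\{0,1\}^n\},\qquad \lambda(d,s):=\lim_{n\to\infty}\frac{\Lambda(n,d,s)}{\binom nd\,2^{n-d}}.$$ Then the limits $\lambda(3,2)$, $\lambda(4,2)$ and $\lambda(4,4)$ exist, and $$\lambda(3,2)=\frac89,\qquad \lambda(4,2)=\frac{264}{343},\qquad \lambda(4,4)=\frac{26}{27}.$$ -/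

import Mathlib

/-- The `n`-dimensional hypercube graph `Q_n` on binary sequences of length `n`: two sequences are
adjacent when they differ in exactly one coordinate. -/
def hypercubeGraph (n : ℕ) : SimpleGraph (Fin n → Bool) where
  Adj x y := hammingDist x y = 1
  symm := ⟨fun x y h => by rw [hammingDist_comm]; exact h⟩
  loopless := ⟨fun x h => by simp at h⟩

/-- A `d`-subcube of `{0,1}^n`: a set of vertices that induces in `Q_n` a copy of `Q_d`. -/
def IsSubcube {n : ℕ} (d : ℕ) (C : Finset (Fin n → Bool)) : Prop :=
  Nonempty (hypercubeGraph d ≃g (hypercubeGraph n).induce (C : Set (Fin n → Bool)))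

open Classical in
/-- `Λ(S,d,s)`: the number of `d`-subcubes that contain exactly `s` points of `S`. -/
noncomputable def subcubeCount {n : ℕ} (S : Finset (Fin n → Bool)) (d s : ℕ) : ℕ :=
  (Finset.univ.filter
    (fun C : Finset (Fin n → Bool) => IsSubcube d C ∧ (S ∩ C).card = s)).card

/-- The statistics function `Λ(n,d,s)`: the maximum of `Λ(S,d,s)` over all `S ⊆ {0,1}^n`. -/
noncomputable def statisticsFunction (n d s : ℕ) : ℕ :=
  (Finset.univ : Finset (Finset (Fin n → Bool))).sup (fun S => subcubeCount S d s)

/-- The maximal density of `d`-subcubes of `{0,1}^n` with exactly `s` configuration points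
(meaningful for `n ≥ d`). -/
noncomputable def statisticsDensity (d s n : ℕ) : ℝ :=
  (statisticsFunction n d s : ℝ) / ((n.choose d : ℝ) * 2 ^ (n - d))

/-- `c` is the statistics constant `λ(d,s)`: the limit of the maximal densities as `n → ∞`
exists and equals `c`. -/
def IsStatisticsConstant (d s : ℕ) (c : ℝ) : Prop :=
  Filter.Tendsto (statisticsDensity d s) Filter.atTop (nhds c)

/-! Lower bounds come from random linear codes. Give every coordinate an independent uniform nonzero
vector of V = F_2^k, and let S consist of the x whose support has vector sum 0. On a subcube this
sum is an affine function of the d cube coordinates, so a subcube whose d direction vectors span V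
meets S in exactly 2^d / |V| points. Random nonzero vectors span with probability 24/27 (d = 3, k =
2), 78/81 (d = 4, k = 2) and 1848/2401 (d = 4, k = 3), and some choice of vectors does at least as
well as the average (`le_statisticsDensity_of_vectors`). This works for every n ≥ d.

Upper bounds come from sums of squares. Fix m = d - 2 directions and a face spanned by them,
coloured σ; let F_k be the colouring of the parallel neighbour in a further direction k. If t_σ is
positive semidefinite, the sum of t_σ(F_k, F_l) over all k, l is nonnegative, and the diagonal
contributes only O(n). Hence the average over placed d-cubes of t_σ(F_k, F_l), read at a corner of
the cube, is at least -O(1/n) (`neg_le_sum_cornerValue`). It therefore suffices to find forms such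
that every colouring of a single d-cube satisfies A·[exactly s points] + (sum of corner values) ≤ B;
averaging yields density at most B/A + O(1/n) (`card_filter_pointCount_le`). The forms below give
B/A equal to the lower bound, and the inequality is a finite check over 2^8 or 2^16 colourings.

Subcubes are counted through placements, that is, a base vertex with an injective list of directions
(`subcubeCount_mul`). -/

/-! ### Placements of a cube in a cube -/

/-- The vertex with coordinate vector `u` of the cube with base point `x` and directions `e`. -/
def place {n d : ℕ} (x : Fin n → Bool) (e : Fin d → Fin n) (u : Fin d → Bool) : Fin n → Bool :=
  fun t => xor (x t) (decide (∃ i, e i = t ∧ u i = true))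

section Place

variable {n d : ℕ}

theorem place_apply_dir (x : Fin n → Bool) {e : Fin d → Fin n} (he : Function.Injective e)
    (u : Fin d → Bool) (i : Fin d) : place x e u (e i) = xor (x (e i)) (u i) := by
  unfold place
  congr 1
  rw [Bool.eq_iff_iff, decide_eq_true_iff]
  constructor
  · rintro ⟨j, hj, hu⟩
    rwa [← he hj]
  · exact fun h => ⟨i, rfl, h⟩

theorem place_apply_of_forall_ne (x : Fin n → Bool) (e : Fin d → Fin n) (u : Fin d → Bool)
    {t : Fin n} (ht : ∀ i, e i ≠ t) : place x e u t = x t := by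
  unfold place
  simp [ht]

theorem place_place (x : Fin n → Bool) {e : Fin d → Fin n} (he : Function.Injective e)
    (v : Fin d → Bool) (p : Fin d → Fin d) (u : Fin d → Bool) :
    place (place x e v) (e ∘ p) u = place x e (place v p u) := by
  funext t
  by_cases ht : ∃ j, e j = t
  · obtain ⟨j, rfl⟩ := ht
    rw [place_apply_dir x he]
    show xor (place x e v (e j)) (decide (∃ i, e (p i) = e j ∧ u i = true)) = _
    rw [place_apply_dir x he]
    simp only [he.eq_iff, place, Bool.xor_assoc]
  · push Not at ht
    rw [place_apply_of_forall_ne x e _ ht, place_apply_of_forall_ne _ (e ∘ p) _ (fun i => ht (p i)),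
      place_apply_of_forall_ne x e _ ht]

theorem place_injective (x : Fin n → Bool) {e : Fin d → Fin n} (he : Function.Injective e) :
    Function.Injective (place x e) := by
  intro u v h
  funext i
  have := congrFun h (e i)
  rw [place_apply_dir x he, place_apply_dir x he] at this
  simpa using this

theorem place_zero (x : Fin n → Bool) (e : Fin d → Fin n) :
    place x e (fun _ => false) = x := by
  funext t; simp [place]

theorem place_place_same (x : Fin n → Bool) (e : Fin d → Fin n) (u : Fin d → Bool) :
    place (place x e u) e u = x := by
  funext t; simp [place]

theorem hammingDist_place (x : Fin n → Bool) {e : Fin d → Fin n} (he : Function.Injective e)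
    (u v : Fin d → Bool) : hammingDist (place x e u) (place x e v) = hammingDist u v := by
  classical
  unfold hammingDist
  rw [← Finset.card_image_of_injective _ he]
  congr 1
  ext t
  simp only [Finset.mem_filter, Finset.mem_univ, true_and, Finset.mem_image]
  constructor
  · intro h
    by_cases ht : ∃ j, e j = t
    · obtain ⟨j, rfl⟩ := ht
      rw [place_apply_dir x he, place_apply_dir x he] at h
      exact ⟨j, fun h' => h (by rw [h']), rfl⟩
    · push Not at ht
      rw [place_apply_of_forall_ne x e _ ht, place_apply_of_forall_ne x e _ ht] at h
      exact absurd rfl h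
  · rintro ⟨j, hj, rfl⟩
    rw [place_apply_dir x he, place_apply_dir x he]
    simpa using hj

/-! ### Coordinate flips and adjacency-preserving maps -/

/-- The vertex obtained from `x` by changing coordinate `t`. -/
def flipAt (x : Fin n → Bool) (t : Fin n) : Fin n → Bool := Function.update x t (!x t)

theorem flipAt_same (x : Fin n → Bool) (t : Fin n) : flipAt x t t = !x t := by simp [flipAt]

theorem flipAt_of_ne (x : Fin n → Bool) {t r : Fin n} (h : r ≠ t) : flipAt x t r = x r := by
  simp [flipAt, h]

theorem flipAt_flipAt (x : Fin n → Bool) (t : Fin n) : flipAt (flipAt x t) t = x := by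
  simp [flipAt]

theorem flipAt_inj {x : Fin n → Bool} {t r : Fin n} (h : flipAt x t = flipAt x r) : t = r := by
  by_contra hne
  have := congrFun h t
  rw [flipAt_same, flipAt_of_ne x hne] at this
  simp at this

theorem hammingDist_eq_one_iff {x y : Fin n → Bool} :
    hammingDist x y = 1 ↔ ∃ t, y = flipAt x t := by
  unfold hammingDist
  rw [Finset.card_eq_one]
  constructor
  · rintro ⟨t, ht⟩
    refine ⟨t, funext fun r => ?_⟩
    have hr : x r ≠ y r ↔ r = t := by
      have := Finset.ext_iff.1 ht r
      simpa using this
    by_cases h : r = t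
    · subst h
      rw [flipAt_same]
      have := hr.2 rfl
      revert this
      cases x r <;> cases y r <;> simp
    · rw [flipAt_of_ne x h]
      by_contra h'
      exact h (hr.1 (Ne.symm h'))
  · rintro ⟨t, rfl⟩
    refine ⟨t, ?_⟩
    ext r
    simp only [Finset.mem_filter, Finset.mem_univ, true_and, Finset.mem_singleton]
    constructor
    · intro h
      by_contra h'
      exact h (flipAt_of_ne x h').symm
    · rintro rfl
      rw [flipAt_same]; simp

theorem flipAt_flipAt_eq {x : Fin n → Bool} {p q a b : Fin n} (hpq : p ≠ q)
    (h : flipAt (flipAt x p) a = flipAt (flipAt x q) b) : a = p ∨ a = q := by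
  by_contra! hne
  have h1 := congrFun h p
  have h2 := congrFun h q
  rw [flipAt_of_ne _ hne.1.symm, flipAt_same] at h1
  rw [flipAt_of_ne _ hne.2.symm, flipAt_of_ne _ hpq.symm] at h2
  by_cases hb : b = p
  · subst hb
    rw [flipAt_of_ne _ hpq.symm, flipAt_same] at h2
    simp at h2
  · rw [flipAt_of_ne _ (Ne.symm hb), flipAt_of_ne _ hpq] at h1
    simp at h1

theorem place_flipAt (x : Fin n → Bool) {e : Fin d → Fin n} (he : Function.Injective e)
    (u : Fin d → Bool) (i : Fin d) : place x e (flipAt u i) = flipAt (place x e u) (e i) := by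
  funext t
  by_cases ht : ∃ j, e j = t
  · obtain ⟨j, rfl⟩ := ht
    rw [place_apply_dir x he]
    by_cases hj : j = i
    · subst hj
      rw [flipAt_same, flipAt_same, place_apply_dir x he]
      simp
    · rw [flipAt_of_ne _ hj, flipAt_of_ne _ (he.ne hj), place_apply_dir x he]
  · push Not at ht
    rw [flipAt_of_ne _ (ht i).symm, place_apply_of_forall_ne x e _ ht,
      place_apply_of_forall_ne x e _ ht]

/-- An injective adjacency-preserving map between hypercubes is a placement. -/
theorem exists_eq_place (φ : (Fin d → Bool) → (Fin n → Bool)) (hφ : Function.Injective φ)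
    (hadj : ∀ u v, hammingDist u v = 1 → hammingDist (φ u) (φ v) = 1) :
    ∃ e : Fin d → Fin n, Function.Injective e ∧ φ = place (φ fun _ => false) e := by
  set o : Fin d → Bool := fun _ => false with ho
  have hstep : ∀ u i, ∃ t, φ (flipAt u i) = flipAt (φ u) t := fun u i =>
    hammingDist_eq_one_iff.1 (hadj _ _ (hammingDist_eq_one_iff.2 ⟨i, rfl⟩))
  choose e he using hstep o
  have hinj : Function.Injective e := by
    intro i j hij
    have : φ (flipAt o i) = φ (flipAt o j) := by rw [he, he, hij]
    exact flipAt_inj (hφ this)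
  refine ⟨e, hinj, ?_⟩
  -- Induction on the weight of `u`; weights 0 and 1 hold by the choice of `e`.
  have key : ∀ k u, (Finset.univ.filter fun i => u i = true).card = k → φ u = place (φ o) e u := by
    intro k
    induction k using Nat.strong_induction_on with
    | _ k ih =>
      intro u hu
      have hcard : ∀ (w : Fin d → Bool) (i : Fin d), w i = true →
          (Finset.univ.filter fun j => flipAt w i j = true).card <
            (Finset.univ.filter fun j => w j = true).card := by
        intro w i hi
        apply Finset.card_lt_card
        refine ⟨fun j hj => ?_, fun hsub => ?_⟩
        · simp only [Finset.mem_filter, Finset.mem_univ, true_and] at hj ⊢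
          by_cases h : j = i
          · rw [h, hi]
          · rwa [flipAt_of_ne _ h] at hj
        · have := hsub (show i ∈ _ by simpa using hi)
          simp [flipAt_same, hi] at this
      by_cases h0 : ∃ i, u i = true
      · obtain ⟨i, hi⟩ := h0
        by_cases h1 : ∃ j, j ≠ i ∧ u j = true
        · obtain ⟨j, hji, hj⟩ := h1
          have e1 : φ (flipAt u i) = flipAt (place (φ o) e u) (e i) := by
            rw [← place_flipAt _ hinj]; exact ih _ (hu ▸ hcard u i hi) _ rfl
          have e2 : φ (flipAt u j) = flipAt (place (φ o) e u) (e j) := by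
            rw [← place_flipAt _ hinj]; exact ih _ (hu ▸ hcard u j hj) _ rfl
          have e3 : φ (flipAt (flipAt u i) j) = flipAt (flipAt (place (φ o) e u) (e i)) (e j) := by
            rw [← place_flipAt _ hinj, ← place_flipAt _ hinj]
            refine ih _ (hu ▸ (hcard _ j ?_).trans (hcard u i hi)) _ rfl
            rwa [flipAt_of_ne _ hji]
          obtain ⟨a, ha⟩ := hstep (flipAt u i) i
          obtain ⟨b, hb⟩ := hstep (flipAt u j) j
          rw [flipAt_flipAt, e1] at ha
          rw [flipAt_flipAt, e2] at hb
          -- `φ u` is a common neighbour of two vertices at distance 2. There are only two such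
          -- vertices; one is the desired value, the other is already the image of `u` with both `i`
          -- and `j` flipped.
          rcases flipAt_flipAt_eq (hinj.ne hji.symm) (ha.symm.trans hb) with rfl | rfl
          · rw [ha, flipAt_flipAt]
          · exfalso
            have := hφ (ha.trans e3.symm)
            have := congrFun this i
            rw [flipAt_of_ne _ hji.symm, flipAt_same, hi] at this
            simp at this
        · push Not at h1
          have : u = flipAt o i := by
            funext j
            by_cases h : j = i
            · rw [h, flipAt_same, hi]; rfl
            · rw [flipAt_of_ne _ h]
              simpa using h1 j h
          rw [this, he, place_flipAt _ hinj, ho, place_zero]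
      · push Not at h0
        have : u = o := by funext j; simpa using h0 j
        rw [this, ho, place_zero]
  exact funext fun u => key _ u rfl

/-! ### Subcubes as images of placements -/

/-- The vertex set of a placed cube. -/
def placeImage (x : Fin n → Bool) (e : Fin d → Fin n) : Finset (Fin n → Bool) :=
  Finset.univ.image (place x e)

theorem isSubcube_iff {C : Finset (Fin n → Bool)} :
    IsSubcube d C ↔ ∃ x e, Function.Injective e ∧ placeImage (d := d) x e = C := by
  constructor
  · rintro ⟨φ⟩
    obtain ⟨e, he, h⟩ := exists_eq_place (fun u => (φ u : Fin n → Bool))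
      (Subtype.val_injective.comp φ.injective) (fun u v huv => by
        have : (hypercubeGraph d).Adj u v := huv
        exact φ.map_rel_iff.2 this)
    refine ⟨(φ fun _ => false : Fin n → Bool), e, he, ?_⟩
    unfold placeImage
    rw [← h]
    ext y
    simp only [Finset.mem_image, Finset.mem_univ, true_and]
    constructor
    · rintro ⟨u, rfl⟩
      exact (φ u).2
    · intro hy
      exact ⟨φ.symm ⟨y, hy⟩, by simp⟩
  · rintro ⟨x, e, he, rfl⟩
    refine ⟨⟨Equiv.ofBijective
      (fun u => ⟨place x e u, by simp [placeImage]⟩) ⟨?_, ?_⟩, ?_⟩⟩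
    · intro u v h
      exact place_injective x he (congrArg Subtype.val h)
    · rintro ⟨y, hy⟩
      simp only [placeImage, Finset.coe_image, Finset.coe_univ, Set.image_univ, Set.mem_range] at hy
      obtain ⟨u, rfl⟩ := hy
      exact ⟨u, rfl⟩
    · intro u v
      show hammingDist (place x e u) (place x e v) = 1 ↔ hammingDist u v = 1
      rw [hammingDist_place x he]

end Place

/-! ### Counting subcubes through placements -/

section Counting

variable {n d : ℕ}

/-- All placements of the `d`-cube in the `n`-cube. -/
def placements (n d : ℕ) : Finset ((Fin n → Bool) × (Fin d → Fin n)) :=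
  Finset.univ.filter fun q => Function.Injective q.2

theorem mem_placements {q : (Fin n → Bool) × (Fin d → Fin n)} :
    q ∈ placements n d ↔ Function.Injective q.2 := by simp [placements]

theorem card_injective_functions (n d : ℕ) :
    (Finset.univ.filter fun e : Fin d → Fin n => Function.Injective e).card =
      n.descFactorial d := by
  classical
  rw [← Fintype.card_subtype, Fintype.card_congr (Equiv.subtypeInjectiveEquivEmbedding _ _),
    Fintype.card_embedding_eq, Fintype.card_fin, Fintype.card_fin]

theorem placements_eq_product (n d : ℕ) :
    placements n d = Finset.univ ×ˢ
      (Finset.univ.filter fun e : Fin d → Fin n => Function.Injective e) := by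
  ext q; simp [placements]

theorem card_placements (n d : ℕ) : (placements n d).card = 2 ^ n * n.descFactorial d := by
  rw [placements_eq_product, Finset.card_product, card_injective_functions]
  simp

/-- The number of points of `S` in a placed cube. -/
def pointCount (S : Finset (Fin n → Bool)) (x : Fin n → Bool) (e : Fin d → Fin n) : ℕ :=
  (Finset.univ.filter fun u => place x e u ∈ S).card

theorem card_inter_placeImage (S : Finset (Fin n → Bool)) (x : Fin n → Bool)
    {e : Fin d → Fin n} (he : Function.Injective e) :
    (S ∩ placeImage x e).card = pointCount S x e := by
  unfold pointCount
  rw [← Finset.card_image_of_injective _ (place_injective x he)]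
  congr 1
  ext y
  simp only [placeImage, Finset.mem_inter, Finset.mem_image, Finset.mem_univ, true_and,
    Finset.mem_filter]
  constructor
  · rintro ⟨hy, u, rfl⟩
    exact ⟨u, hy, rfl⟩
  · rintro ⟨u, hu, rfl⟩
    exact ⟨hu, u, rfl⟩

theorem place_mem_placeImage (x : Fin n → Bool) (e : Fin d → Fin n) (u : Fin d → Bool) :
    place x e u ∈ placeImage x e := Finset.mem_image_of_mem _ (Finset.mem_univ _)

/-- Placements with the same image differ by a symmetry of the cube. -/
theorem placeImage_eq_iff {x x' : Fin n → Bool} {e e' : Fin d → Fin n}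
    (he : Function.Injective e) (he' : Function.Injective e') :
    placeImage x' e' = placeImage x e ↔
      ∃ (v : Fin d → Bool) (p : Equiv.Perm (Fin d)), place x e v = x' ∧ e ∘ p = e' := by
  constructor
  · intro h
    have hx : x' ∈ placeImage x e := by
      rw [← h]
      have := place_mem_placeImage x' e' (fun _ => false)
      rwa [place_zero] at this
    obtain ⟨v, -, hv⟩ := Finset.mem_image.1 hx
    -- A direction of the second cube foreign to the first would change a coordinate that is
    -- constant on the first image.
    have hdir : ∀ i, ∃ j, e j = e' i := by
      intro i
      by_contra! hne
      have hmem := place_mem_placeImage x' e' (flipAt (fun _ => false) i)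
      rw [h, place_flipAt _ he', place_zero] at hmem
      obtain ⟨w, -, hw⟩ := Finset.mem_image.1 hmem
      have := congrFun hw (e' i)
      rw [flipAt_same, ← hv, place_apply_of_forall_ne x e w hne,
        place_apply_of_forall_ne x e v hne] at this
      simp at this
    choose p hp using hdir
    have hpinj : Function.Injective p := by
      intro i j hij
      apply he'
      rw [← hp, ← hp, hij]
    exact ⟨v, Equiv.ofBijective p (Finite.injective_iff_bijective.1 hpinj), hv, funext hp⟩
  · rintro ⟨v, p, rfl, rfl⟩
    apply Finset.eq_of_subset_of_card_le
    · intro y hy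
      obtain ⟨w, -, rfl⟩ := Finset.mem_image.1 hy
      rw [place_place x he]
      exact place_mem_placeImage x e _
    · unfold placeImage
      rw [Finset.card_image_of_injective _ (place_injective x he),
        Finset.card_image_of_injective _ (place_injective _ (he.comp p.injective))]

/-- Each subcube is the image of exactly 2^d · d! placements: choose its base vertex and the order
of its directions. -/
theorem subcubeCount_mul (S : Finset (Fin n → Bool)) (d s : ℕ) :
    subcubeCount S d s * (2 ^ d * d.factorial) =
      ((placements n d).filter fun q => pointCount S q.1 q.2 = s).card := by
  classical
  unfold subcubeCount
  rw [Finset.card_eq_sum_card_fiberwise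
    (f := fun q : (Fin n → Bool) × (Fin d → Fin n) => placeImage q.1 q.2)
    (t := Finset.univ.filter fun C => IsSubcube d C ∧ (S ∩ C).card = s), ← smul_eq_mul,
    ← Finset.sum_const]
  · refine Finset.sum_congr rfl fun C hC => ?_
    simp only [Finset.mem_filter, Finset.mem_univ, true_and] at hC
    obtain ⟨hC, hs⟩ := hC
    obtain ⟨x, e, he, rfl⟩ := isSubcube_iff.1 hC
    have hinj : Function.Injective
        (fun r : (Fin d → Bool) × Equiv.Perm (Fin d) => (place x e r.1, e ∘ r.2)) := by
      rintro ⟨v, p⟩ ⟨v', p'⟩ h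
      simp only [Prod.mk.injEq] at h
      refine Prod.ext (place_injective x he h.1) (Equiv.ext fun i => he ?_)
      exact congrFun h.2 i
    have : (2 ^ d * d.factorial) =
        (Finset.univ : Finset ((Fin d → Bool) × Equiv.Perm (Fin d))).card := by
      simp [Fintype.card_perm]
    rw [this, ← Finset.card_image_of_injective _ hinj]
    congr 1
    ext ⟨x', e'⟩
    simp only [Finset.mem_image, Finset.mem_univ, true_and, Prod.exists, Prod.mk.injEq,
      Finset.mem_filter, mem_placements]
    constructor
    · rintro ⟨v, p, rfl, rfl⟩
      have he' := he.comp p.injective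
      have himg := (placeImage_eq_iff (x := x) he he').2 ⟨v, p, rfl, rfl⟩
      refine ⟨⟨he', ?_⟩, himg⟩
      rw [← card_inter_placeImage S _ he', himg, hs]
    · rintro ⟨⟨he', -⟩, himg⟩
      exact (placeImage_eq_iff he he').1 himg
  · rintro ⟨x, e⟩ hq
    simp only [Finset.coe_filter, Set.mem_ofPred_eq, mem_placements, Finset.mem_univ,
      true_and] at hq ⊢
    exact ⟨isSubcube_iff.2 ⟨x, e, hq.1, rfl⟩, by rw [card_inter_placeImage S x hq.1, hq.2]⟩

/-- The proportion of placements of the `d`-cube with exactly `s` points of `S`. -/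
theorem subcubeCount_div (S : Finset (Fin n → Bool)) {d : ℕ} (s : ℕ) (hd : d ≤ n) :
    (subcubeCount S d s : ℝ) / ((n.choose d : ℝ) * 2 ^ (n - d)) =
      (((placements n d).filter fun q => pointCount S q.1 q.2 = s).card : ℝ) /
        (2 ^ n * n.descFactorial d) := by
  rw [← subcubeCount_mul, Nat.descFactorial_eq_factorial_mul_choose]
  have h1 : (2 : ℝ) ^ n = 2 ^ (n - d) * 2 ^ d := by rw [← pow_add, Nat.sub_add_cancel hd]
  have h2 : (d.factorial : ℝ) ≠ 0 := by exact_mod_cast d.factorial_ne_zero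
  have h3 : (n.choose d : ℝ) ≠ 0 := by exact_mod_cast (Nat.choose_pos hd).ne'
  rw [h1]
  push_cast
  field_simp

end Counting

/-! ### Positive kernels and the averaging bound -/

/-- A kernel all of whose finite quadratic sums are nonnegative. -/
def IsPosKernel {α : Type*} (t : α → α → ℤ) : Prop :=
  ∀ (n : ℕ) (s : Finset (Fin n)) (F : Fin n → α), 0 ≤ ∑ k ∈ s, ∑ l ∈ s, t (F k) (F l)

namespace IsPosKernel

variable {α β : Type*}

theorem mul_self (g : α → ℤ) : IsPosKernel fun a b => g a * g b := by
  intro n s F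
  rw [← Finset.sum_mul_sum]
  exact mul_self_nonneg _

theorem zero : IsPosKernel fun _ _ : α => (0 : ℤ) := by
  intro n s F; simp

theorem add {t t' : α → α → ℤ} (h : IsPosKernel t) (h' : IsPosKernel t') :
    IsPosKernel fun a b => t a b + t' a b := by
  intro n s F
  simp only [Finset.sum_add_distrib]
  exact add_nonneg (h n s F) (h' n s F)

theorem const_mul {t : α → α → ℤ} (h : IsPosKernel t) (w : ℕ) :
    IsPosKernel fun a b => (w : ℤ) * t a b := by
  intro n s F
  simp only [← Finset.mul_sum]
  exact mul_nonneg (Int.natCast_nonneg w) (h n s F)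

theorem comp {t : α → α → ℤ} (h : IsPosKernel t) (f : β → α) :
    IsPosKernel fun a b => t (f a) (f b) := fun n s F => h n s fun k => f (F k)

end IsPosKernel

section Upper

variable {n m : ℕ}

theorem sum_fin_succ_function {κ M : Type*} [Fintype κ] [AddCommMonoid M] (d : ℕ)
    (f : (Fin (d + 1) → κ) → M) :
    ∑ e, f e = ∑ e : Fin d → κ, ∑ k : κ, f (Fin.cons k e) := by
  classical
  rw [← (Fin.consEquiv fun _ : Fin (d + 1) => κ).sum_comp, Fintype.sum_prod_type_right]
  rfl

theorem place_cons_false (x : Fin n → Bool) (k : Fin n) (e : Fin m → Fin n) (w : Fin m → Bool) :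
    place x (Fin.cons k e : Fin (m + 1) → Fin n) (Fin.cons false w : Fin (m + 1) → Bool) =
      place x e w := by
  funext t
  simp [place, Fin.exists_fin_succ]

theorem place_cons_true_cons_false (x : Fin n → Bool) (k l : Fin n) (e : Fin m → Fin n)
    (w : Fin m → Bool) :
    place x (Fin.cons k (Fin.cons l e : Fin (m + 1) → Fin n) : Fin (m + 2) → Fin n)
      (Fin.cons true (Fin.cons false w : Fin (m + 1) → Bool) : Fin (m + 2) → Bool) =
      place x (Fin.cons k e : Fin (m + 1) → Fin n) (Fin.cons true w : Fin (m + 1) → Bool) := by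
  funext t
  simp [place, Fin.exists_fin_succ]

/-- The colouring that `S` induces on a placed cube. -/
def coloring {d : ℕ} (S : Finset (Fin n → Bool)) (x : Fin n → Bool) (e : Fin d → Fin n) :
    (Fin d → Bool) → Bool := fun u => decide (place x e u ∈ S)

/-- The face of a coloured cube on which the first two coordinates are `a` and `b`. -/
def face (c : (Fin (m + 2) → Bool) → Bool) (a b : Bool) : (Fin m → Bool) → Bool :=
  fun w => c (Fin.cons a (Fin.cons b w : Fin (m + 1) → Bool) : Fin (m + 2) → Bool)

/-- The value of a kernel at two faces of a coloured cube adjacent to a common face. -/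
def cornerValue (t : ((Fin m → Bool) → Bool) → ((Fin m → Bool) → Bool) → ((Fin m → Bool) → Bool) → ℤ)
    (c : (Fin (m + 2) → Bool) → Bool) : ℤ :=
  t (face c false false) (face c true false) (face c false true)

/-- The full double sum is nonnegative, and removing the diagonal costs at most `K` per index. -/
theorem neg_le_sum_offDiag {α : Type*} {t : α → α → ℤ} (ht : IsPosKernel t) {K : ℕ}
    (hK : ∀ a, t a a ≤ K) (s : Finset (Fin n)) (F : Fin n → α) :
    -((K : ℤ) * n) ≤ ∑ l ∈ s, ∑ k ∈ s, if k = l then 0 else t (F k) (F l) := by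
  have h1 : ∑ l ∈ s, ∑ k ∈ s, t (F k) (F l) =
      (∑ l ∈ s, ∑ k ∈ s, if k = l then 0 else t (F k) (F l)) + ∑ l ∈ s, t (F l) (F l) := by
    rw [← Finset.sum_add_distrib]
    refine Finset.sum_congr rfl fun l hl => ?_
    have : t (F l) (F l) = ∑ k ∈ s, if k = l then t (F k) (F l) else 0 := by
      rw [Finset.sum_ite_eq' s l]; simp [hl]
    rw [this, ← Finset.sum_add_distrib]
    refine Finset.sum_congr rfl fun k _ => ?_
    split_ifs <;> simp
  have h2 : 0 ≤ ∑ l ∈ s, ∑ k ∈ s, t (F k) (F l) := by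
    rw [Finset.sum_comm]; exact ht n s F
  have h3 : ∑ l ∈ s, t (F l) (F l) ≤ (K : ℤ) * n := by
    calc ∑ l ∈ s, t (F l) (F l) ≤ ∑ _l ∈ s, (K : ℤ) := Finset.sum_le_sum fun l _ => hK _
      _ = s.card * (K : ℤ) := by simp
      _ ≤ n * (K : ℤ) := by
        have : s.card ≤ n := by simpa using Finset.card_le_univ s
        gcongr
      _ = _ := mul_comm _ _
  linarith

/-- With the base point and the last `m` directions fixed, the corner face is fixed, and the sum
over the first two directions is an off-diagonal kernel sum. The 2^n · n^m choices each lose at most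
`K * n`. -/
theorem neg_le_sum_cornerValue
    {t : ((Fin m → Bool) → Bool) → ((Fin m → Bool) → Bool) → ((Fin m → Bool) → Bool) → ℤ}
    (ht : ∀ σ, IsPosKernel (t σ)) {K : ℕ} (hK : ∀ σ F, t σ F F ≤ K)
    (S : Finset (Fin n → Bool)) :
    -((K : ℤ) * 2 ^ n * n ^ (m + 1)) ≤
      ∑ q ∈ placements n (m + 2), cornerValue t (coloring S q.1 q.2) := by
  classical
  rw [placements_eq_product, Finset.sum_product]
  have key : ∀ x : Fin n → Bool, -((K : ℤ) * n ^ (m + 1)) ≤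
      ∑ e ∈ Finset.univ.filter (fun e : Fin (m + 2) → Fin n => Function.Injective e),
        cornerValue t (coloring S x e) := by
    intro x
    rw [Finset.sum_filter, sum_fin_succ_function, sum_fin_succ_function]
    have hstep : ∀ e : Fin m → Fin n, -((K : ℤ) * n) ≤ ∑ l : Fin n, ∑ k : Fin n,
        if Function.Injective (Fin.cons k (Fin.cons l e : Fin (m + 1) → Fin n) :
            Fin (m + 2) → Fin n) then
          cornerValue t (coloring S x
            (Fin.cons k (Fin.cons l e : Fin (m + 1) → Fin n) : Fin (m + 2) → Fin n)) else 0 := by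
      intro e
      by_cases he : Function.Injective e
      · set s : Finset (Fin n) := Finset.univ.filter fun k => k ∉ Set.range e with hs
        refine (neg_le_sum_offDiag (ht (coloring S x e)) (hK _) s fun k w =>
          decide (place x (Fin.cons k e : Fin (m + 1) → Fin n)
            (Fin.cons true w : Fin (m + 1) → Bool) ∈ S)).trans (le_of_eq ?_)
        rw [hs, Finset.sum_filter]
        refine Finset.sum_congr rfl fun l _ => ?_
        rw [Finset.sum_filter]
        by_cases hl : l ∈ Set.range e
        · rw [if_neg (not_not_intro hl)]
          symm
          refine Finset.sum_eq_zero fun k _ => if_neg ?_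
          rw [Fin.cons_injective_iff, Fin.cons_injective_iff]
          tauto
        · rw [if_pos hl]
          refine Finset.sum_congr rfl fun k _ => ?_
          have hiff : Function.Injective (Fin.cons k (Fin.cons l e : Fin (m + 1) → Fin n) :
              Fin (m + 2) → Fin n) ↔ k ∉ Set.range e ∧ ¬ k = l := by
            rw [Fin.cons_injective_iff, Fin.cons_injective_iff, Fin.range_cons]
            simp only [Set.mem_insert_iff]
            tauto
          by_cases hk : k ∈ Set.range e
          · rw [if_neg (not_not_intro hk), if_neg (fun h => (hiff.1 h).1 hk)]
          · rw [if_pos hk]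
            by_cases hkl : k = l
            · rw [if_pos hkl, if_neg (fun h => (hiff.1 h).2 hkl)]
            · rw [if_neg hkl, if_pos (hiff.2 ⟨hk, hkl⟩)]
              unfold cornerValue face coloring
              simp only [place_cons_false, place_cons_true_cons_false]
      · rw [Finset.sum_eq_zero]
        · have : (0 : ℤ) ≤ (K : ℤ) * n := by positivity
          linarith
        · intro l _
          refine Finset.sum_eq_zero fun k _ => if_neg ?_
          rw [Fin.cons_injective_iff, Fin.cons_injective_iff]
          tauto
    calc -((K : ℤ) * n ^ (m + 1)) = ∑ _e : Fin m → Fin n, -((K : ℤ) * n) := by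
          simp [pow_succ]; ring
      _ ≤ _ := Finset.sum_le_sum fun e _ => hstep e
  calc -((K : ℤ) * 2 ^ n * n ^ (m + 1))
      = ∑ _x : Fin n → Bool, -((K : ℤ) * n ^ (m + 1)) := by simp; ring
    _ ≤ _ := Finset.sum_le_sum fun x _ => key x

/-- Precomposing with a symmetry of the `d`-cube permutes the placements, so every corner of the
cube has the same average. -/
theorem sum_placements_symm {d : ℕ} (v : Fin d → Bool) {p : Fin d → Fin d}
    (hp : Function.Injective p) (S : Finset (Fin n → Bool)) (f : ((Fin d → Bool) → Bool) → ℤ) :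
    ∑ q ∈ placements n d, f (fun u => coloring S q.1 q.2 (place v p u)) =
      ∑ q ∈ placements n d, f (coloring S q.1 q.2) := by
  set P : Equiv.Perm (Fin d) := Equiv.ofBijective p (Finite.injective_iff_bijective.1 hp)
  have hP : ∀ e : Fin d → Fin n, (e ∘ p) ∘ P.symm = e := by
    intro e; funext i
    exact congrArg e (P.apply_symm_apply i)
  have hP' : ∀ e : Fin d → Fin n, (e ∘ P.symm) ∘ p = e := by
    intro e; funext i
    exact congrArg e (P.symm_apply_apply i)
  refine Finset.sum_bij' (fun q _ => (place q.1 q.2 v, q.2 ∘ p))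
    (fun q _ => (place q.1 (q.2 ∘ P.symm) v, q.2 ∘ P.symm)) ?_ ?_ ?_ ?_ ?_
  · intro q hq
    exact mem_placements.2 ((mem_placements.1 hq).comp hp)
  · intro q hq
    exact mem_placements.2 ((mem_placements.1 hq).comp P.symm.injective)
  · rintro ⟨x, e⟩ hq
    simp only [hP, place_place_same]
  · rintro ⟨x, e⟩ hq
    simp only [hP', place_place_same]
  · rintro ⟨x, e⟩ hq
    congr 1
    funext u
    simp only [coloring, place_place x (mem_placements.1 hq)]

/-- The averaging bound: a pointwise inequality on colourings of the `(m+2)`-cube that involves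
a positive kernel bounds the number of placements with exactly `s` points. -/
theorem card_filter_pointCount_le
    {t : ((Fin m → Bool) → Bool) → ((Fin m → Bool) → Bool) → ((Fin m → Bool) → Bool) → ℤ}
    (ht : ∀ σ, IsPosKernel (t σ)) {K : ℕ} (hK : ∀ σ F, t σ F F ≤ K)
    (Γ : List ((Fin (m + 2) → Bool) × (Fin (m + 2) → Fin (m + 2))))
    (hΓ : ∀ γ ∈ Γ, Function.Injective γ.2) {A B s : ℕ}
    (hcert : ∀ c : (Fin (m + 2) → Bool) → Bool,
      (if ∑ u, (c u).toNat = s then (A : ℤ) else 0) +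
        (Γ.map fun γ => cornerValue t fun u => c (place γ.1 γ.2 u)).sum ≤ B)
    (S : Finset (Fin n → Bool)) :
    A * ((placements n (m + 2)).filter fun q => pointCount S q.1 q.2 = s).card ≤
      B * (2 ^ n * n.descFactorial (m + 2)) + Γ.length * (K * 2 ^ n * n ^ (m + 1)) := by
  have hsum : ∀ L : List ((Fin (m + 2) → Bool) × (Fin (m + 2) → Fin (m + 2))),
      (∀ γ ∈ L, Function.Injective γ.2) →
      -((L.length : ℤ) * (K * 2 ^ n * n ^ (m + 1))) ≤ ∑ q ∈ placements n (m + 2),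
        (L.map fun γ => cornerValue t fun u => coloring S q.1 q.2 (place γ.1 γ.2 u)).sum := by
    intro L hL
    induction L with
    | nil => simp
    | cons γ L ih =>
      simp only [List.map_cons, List.sum_cons, List.length_cons, Finset.sum_add_distrib]
      have h1 := sum_placements_symm γ.1 (hL γ (by simp)) S (cornerValue t)
      have h2 := neg_le_sum_cornerValue ht hK S
      have h3 := ih fun γ' h' => hL γ' (by simp [h'])
      rw [h1]
      push_cast
      linarith
  have h1 := hsum Γ hΓ
  have h2 := Finset.sum_le_sum (s := placements n (m + 2)) fun q _ =>
    hcert (coloring S q.1 q.2)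
  rw [Finset.sum_add_distrib, Finset.sum_const, card_placements, ← Finset.sum_filter,
    Finset.sum_const] at h2
  have h3 : ∀ q : (Fin n → Bool) × (Fin (m + 2) → Fin n),
      ∑ u, (coloring S q.1 q.2 u).toNat = pointCount S q.1 q.2 := by
    intro q
    rw [pointCount, Finset.card_filter]
    refine Finset.sum_congr rfl fun u _ => ?_
    by_cases h : place q.1 q.2 u ∈ S <;> simp [coloring, h]
  simp only [h3, nsmul_eq_mul] at h2
  push_cast at h2
  have h4 : ((A * ((placements n (m + 2)).filter fun q => pointCount S q.1 q.2 = s).card : ℕ) : ℤ) ≤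
      ((B * (2 ^ n * n.descFactorial (m + 2)) + Γ.length * (K * 2 ^ n * n ^ (m + 1)) : ℕ) : ℤ) := by
    push_cast
    linarith
  exact_mod_cast h4

end Upper

/-! ### From finite bounds to the limit -/

section Limit

open Filter Topology

theorem statisticsDensity_le {d s n : ℕ} (hd : d ≤ n) {b : ℝ}
    (h : ∀ S : Finset (Fin n → Bool),
      (((placements n d).filter fun q => pointCount S q.1 q.2 = s).card : ℝ) ≤
        b * (2 ^ n * n.descFactorial d)) : statisticsDensity d s n ≤ b := by
  obtain ⟨S, -, hS⟩ := Finset.exists_mem_eq_sup (Finset.univ : Finset (Finset (Fin n → Bool)))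
    Finset.univ_nonempty fun S => subcubeCount S d s
  unfold statisticsDensity statisticsFunction
  rw [hS, subcubeCount_div S s hd, div_le_iff₀]
  · exact h S
  · have : 0 < n.descFactorial d := Nat.pos_of_ne_zero fun h0 =>
      absurd (Nat.descFactorial_eq_zero_iff_lt.1 h0) (not_lt.2 hd)
    positivity

theorem le_statisticsDensity {d s n : ℕ} (hd : d ≤ n) {b : ℝ} (S : Finset (Fin n → Bool))
    (h : b * (2 ^ n * n.descFactorial d) ≤
      (((placements n d).filter fun q => pointCount S q.1 q.2 = s).card : ℝ)) :
    b ≤ statisticsDensity d s n := by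
  have hpos : (0 : ℝ) < 2 ^ n * n.descFactorial d := by
    have : 0 < n.descFactorial d := Nat.pos_of_ne_zero fun h0 =>
      absurd (Nat.descFactorial_eq_zero_iff_lt.1 h0) (not_lt.2 hd)
    positivity
  have h1 : b ≤ (subcubeCount S d s : ℝ) / ((n.choose d : ℝ) * 2 ^ (n - d)) := by
    rwa [subcubeCount_div S s hd, le_div_iff₀ hpos]
  refine h1.trans ?_
  unfold statisticsDensity statisticsFunction
  gcongr
  exact Finset.le_sup (f := fun S => subcubeCount S d s) (Finset.mem_univ S)

/-- Each factor of the falling factorial is at least n/2. This makes the error term an O(1/n) share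
of all placements. -/
theorem pow_le_mul_descFactorial {n m : ℕ} (hn : 2 * (m + 1) ≤ n) :
    n * n ^ m ≤ 2 ^ (m + 1) * n.descFactorial (m + 1) := by
  calc n * n ^ m = n ^ (m + 1) := by rw [pow_succ, mul_comm]
    _ ≤ (2 * (n + 1 - (m + 1))) ^ (m + 1) := Nat.pow_le_pow_left (by omega) _
    _ = 2 ^ (m + 1) * (n + 1 - (m + 1)) ^ (m + 1) := mul_pow _ _ _
    _ ≤ _ := Nat.mul_le_mul_left _ (Nat.pow_sub_le_descFactorial n (m + 1))

/-- The statistics constant is `b` if the density is always at least `b` and the number of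
placements exceeds its expected bound by a term of lower order only. -/
theorem isStatisticsConstant_of_bounds {m s : ℕ} {b : ℝ} {K A B : ℕ} (hA : 0 < A)
    (hb : b = (B : ℝ) / A) (hlow : ∀ n, m + 2 ≤ n → b ≤ statisticsDensity (m + 2) s n)
    (hup : ∀ (n : ℕ) (S : Finset (Fin n → Bool)),
      A * ((placements n (m + 2)).filter fun q => pointCount S q.1 q.2 = s).card ≤
        B * (2 ^ n * n.descFactorial (m + 2)) + K * (2 ^ n * n ^ (m + 1))) :
    IsStatisticsConstant (m + 2) s b := by
  unfold IsStatisticsConstant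
  have hlim : Tendsto (fun n : ℕ => b + (K * 2 ^ (m + 2) / A : ℝ) * (1 / (n : ℝ))) atTop (𝓝 b) := by
    have := (tendsto_const_nhds (x := (K * 2 ^ (m + 2) / A : ℝ))).mul
      tendsto_one_div_atTop_nhds_zero_nat
    simpa using (tendsto_const_nhds (x := b)).add this
  refine tendsto_of_tendsto_of_tendsto_of_le_of_le' tendsto_const_nhds hlim ?_ ?_
  · filter_upwards [eventually_ge_atTop (m + 2)] with n hn using hlow n hn
  · filter_upwards [eventually_ge_atTop (2 * (m + 2))] with n hn
    refine statisticsDensity_le (by omega) fun S => ?_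
    have hA' : (0 : ℝ) < A := by exact_mod_cast hA
    have hn' : (0 : ℝ) < n := by
      have : 0 < n := by omega
      exact_mod_cast this
    have h1 : (A * ((placements n (m + 2)).filter fun q => pointCount S q.1 q.2 = s).card : ℝ) ≤
        B * (2 ^ n * n.descFactorial (m + 2)) + K * (2 ^ n * n ^ (m + 1)) := by
      exact_mod_cast hup n S
    have h2 : (n * n ^ (m + 1) : ℝ) ≤ 2 ^ (m + 2) * n.descFactorial (m + 2) := by
      exact_mod_cast pow_le_mul_descFactorial (m := m + 1) hn
    have h3 : (n : ℝ) ^ (m + 1) ≤ 2 ^ (m + 2) * n.descFactorial (m + 2) / n := by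
      rw [le_div_iff₀ hn']; linarith
    have h4 : (K * (2 ^ n * n ^ (m + 1)) : ℝ) ≤
        K * (2 ^ n * (2 ^ (m + 2) * n.descFactorial (m + 2) / n)) := by gcongr
    refine le_of_mul_le_mul_left (h1.trans ((add_le_add_right h4 _).trans (le_of_eq ?_))) hA'
    rw [hb]
    field_simp

end Limit

/-! ### Kernels given by weighted integer vectors -/

/-- The quadratic form `∑ w v(a) v(b)` over a list of pairs `(w, v)`. -/
def formValue (L : List (ℕ × List ℤ)) (a b : ℕ) : ℤ :=
  (L.map fun q => (q.1 : ℤ) * (q.2.getD a 0 * q.2.getD b 0)).sum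

theorem isPosKernel_formValue (L : List (ℕ × List ℤ)) : IsPosKernel (formValue L) := by
  induction L with
  | nil => exact IsPosKernel.zero
  | cons q L ih =>
    exact ((IsPosKernel.mul_self fun a => q.2.getD a 0).const_mul q.1).add ih

/-- There are finitely many colourings; the bound enters only the vanishing error, so its size is
irrelevant. -/
theorem exists_kernel_bound {m : ℕ}
    (t : ((Fin m → Bool) → Bool) → ((Fin m → Bool) → Bool) → ((Fin m → Bool) → Bool) → ℤ) :
    ∃ K : ℕ, ∀ σ F, t σ F F ≤ K := by
  refine ⟨Finset.univ.sup fun q : ((Fin m → Bool) → Bool) × ((Fin m → Bool) → Bool) =>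
    (t q.1 q.2 q.2).toNat, fun σ F => (Int.self_le_toNat _).trans ?_⟩
  exact_mod_cast Finset.le_sup
    (f := fun q : ((Fin m → Bool) → Bool) × ((Fin m → Bool) → Bool) => (t q.1 q.2 q.2).toNat)
    (Finset.mem_univ (σ, F))

/-- A certificate for the upper bound, with a matching lower bound, determines the constant. -/
theorem isStatisticsConstant_of_certificate {m s A B : ℕ} {b : ℝ}
    {t : ((Fin m → Bool) → Bool) → ((Fin m → Bool) → Bool) → ((Fin m → Bool) → Bool) → ℤ}
    (ht : ∀ σ, IsPosKernel (t σ))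
    (Γ : List ((Fin (m + 2) → Bool) × (Fin (m + 2) → Fin (m + 2))))
    (hΓ : ∀ γ ∈ Γ, Function.Injective γ.2) (hA : 0 < A) (hb : b = (B : ℝ) / A)
    (hcert : ∀ c : (Fin (m + 2) → Bool) → Bool,
      (if ∑ u, (c u).toNat = s then (A : ℤ) else 0) +
        (Γ.map fun γ => cornerValue t fun u => c (place γ.1 γ.2 u)).sum ≤ B)
    (hlow : ∀ n, m + 2 ≤ n → b ≤ statisticsDensity (m + 2) s n) :
    IsStatisticsConstant (m + 2) s b := by
  obtain ⟨K, hK⟩ := exists_kernel_bound t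
  refine isStatisticsConstant_of_bounds (K := Γ.length * K) hA hb hlow fun n S => ?_
  have := card_filter_pointCount_le ht hK Γ hΓ hcert S
  rw [mul_assoc K, ← mul_assoc Γ.length] at this
  exact this

/-! ### Colourings as functions of a vertex number -/

theorem ofBits_injective (d : ℕ) : Function.Injective (Nat.ofBits : (Fin d → Bool) → ℕ) := by
  intro u v h
  funext i
  rw [← Nat.testBit_ofBits_lt u i i.2, ← Nat.testBit_ofBits_lt v i i.2, h]

theorem exists_eq_comp_ofBits {d : ℕ} (c : (Fin d → Bool) → Bool) :
    ∃ b : ℕ → Bool, c = fun u => b (Nat.ofBits u) := by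
  refine ⟨fun k => c fun i => k.testBit i, funext fun u => congrArg c (funext fun i => ?_)⟩
  exact (Nat.testBit_ofBits_lt u i i.2).symm

theorem sum_comp_ofBits {d : ℕ} (f : ℕ → ℕ) :
    ∑ u : Fin d → Bool, f (Nat.ofBits u) = ∑ k ∈ Finset.range (2 ^ d), f k := by
  classical
  rw [← Finset.sum_image (g := Nat.ofBits) (f := f) (fun u _ v _ h => ofBits_injective d h)]
  refine Finset.sum_congr (Finset.eq_of_subset_of_card_le ?_ ?_) fun _ _ => rfl
  · intro k hk
    obtain ⟨u, -, rfl⟩ := Finset.mem_image.1 hk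
    exact Finset.mem_range.2 (Nat.ofBits_lt_two_pow u)
  · rw [Finset.card_image_of_injective _ (ofBits_injective d)]
    simp

/-! ### The four parallel faces of a cube in cyclic order -/

/-- The placements that put each of the four faces parallel to the directions `i` between its two
neighbours, where `k` and `l` are the remaining directions. -/
def ringPlacements {d m : ℕ} (k l : Fin d) (dirs : Fin m → Fin d) :
    List ((Fin d → Bool) × (Fin (m + 2) → Fin d)) :=
  [(fun t => decide (t = k), Fin.cons k (Fin.cons l dirs : Fin (m + 1) → Fin d)),
   (fun t => decide (t = k ∨ t = l), Fin.cons l (Fin.cons k dirs : Fin (m + 1) → Fin d)),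
   (fun t => decide (t = l), Fin.cons k (Fin.cons l dirs : Fin (m + 1) → Fin d)),
   (fun _ => false, Fin.cons l (Fin.cons k dirs : Fin (m + 1) → Fin d))]

/-! ### Exactly two points in a three-dimensional cube -/

/-- The number of a coloured edge. -/
def edgeCode (F : (Fin 1 → Bool) → Bool) : ℕ := (F ![false]).toNat + 2 * (F ![true]).toNat

/-- The forms for edges with a given colouring. -/
def edgeForms : ℕ → List (ℕ × List ℤ)
  -- Tightness on the random code: next to an empty edge the codes 0, 1, 2 are equally likely; next
  -- to an edge with one point, the neighbour is empty with probability 2/3 and otherwise has its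
  -- point at the other end. Every vector has mean 0 under these distributions.
  | 0 => [(1, [2, -1, -1, -1]), (3, [0, 1, -1, 0])]
  | 1 => [(1, [1, 0, -2, 0])]
  | 2 => [(1, [1, -2, 0, 0])]
  | _ => []

/-- The kernel on coloured edges. -/
def edgeKernel (σ F F' : (Fin 1 → Bool) → Bool) : ℤ :=
  formValue (edgeForms (edgeCode σ)) (edgeCode F) (edgeCode F')

/-- The placements around the edges of the three-dimensional cube. -/
def edgePlacements : List ((Fin 3 → Bool) × (Fin 3 → Fin 3)) :=
  ringPlacements 1 2 ![0] ++ ringPlacements 0 2 ![1] ++ ringPlacements 0 1 ![2]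

/-- The vertex numbers of a face of a placed three-dimensional cube. -/
def edgeVertices (γ : (Fin 3 → Bool) × (Fin 3 → Fin 3)) (p q : Bool) : ℕ × ℕ :=
  (Nat.ofBits (place γ.1 γ.2 ![p, q, false]), Nat.ofBits (place γ.1 γ.2 ![p, q, true]))

/-- Each of four cyclically arranged faces, followed by its two neighbours. -/
def ringCorners {α : Type*} (f₀ f₁ f₂ f₃ : α) : List (α × α × α) :=
  [(f₁, f₀, f₂), (f₂, f₁, f₃), (f₃, f₂, f₀), (f₀, f₃, f₁)]

/-- Each of the 12 edges occurs once as the centre, with its two parallel neighbours; explicit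
vertex numbers make the sum computable. -/
theorem edgeVertices_placements :
    edgePlacements.map (fun γ => (edgeVertices γ false false, edgeVertices γ true false,
      edgeVertices γ false true)) =
    ringCorners (0, 1) (2, 3) (6, 7) (4, 5) ++ ringCorners (0, 2) (1, 3) (5, 7) (4, 6) ++
      ringCorners (0, 4) (1, 5) (3, 7) (2, 6) := by
  decide +kernel

/-- The number of a coloured edge with given vertex numbers. -/
def edgeCodeAt (b : ℕ → Bool) (f : ℕ × ℕ) : ℕ := (b f.1).toNat + 2 * (b f.2).toNat

theorem sum_edge_cornerValue (b : ℕ → Bool) :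
    (edgePlacements.map fun γ => cornerValue edgeKernel fun u =>
      b (Nat.ofBits (place γ.1 γ.2 u))).sum =
    ((ringCorners (0, 1) (2, 3) (6, 7) (4, 5) ++ ringCorners (0, 2) (1, 3) (5, 7) (4, 6) ++
      ringCorners (0, 4) (1, 5) (3, 7) (2, 6)).map fun f : (ℕ × ℕ) × (ℕ × ℕ) × ℕ × ℕ =>
        formValue (edgeForms (edgeCodeAt b f.1)) (edgeCodeAt b f.2.1) (edgeCodeAt b f.2.2)).sum := by
  rw [← edgeVertices_placements, List.map_map]
  rfl

theorem edge_inequality : ∀ b₀ b₁ b₂ b₃ b₄ b₅ b₆ b₇ : Bool,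
    (if b₀.toNat + b₁.toNat + b₂.toNat + b₃.toNat + b₄.toNat + b₅.toNat + b₆.toNat + b₇.toNat = 2
      then 54 else 0) +
    ((ringCorners (b₀, b₁) (b₂, b₃) (b₆, b₇) (b₄, b₅) ++
      ringCorners (b₀, b₂) (b₁, b₃) (b₅, b₇) (b₄, b₆) ++
      ringCorners (b₀, b₄) (b₁, b₅) (b₃, b₇) (b₂, b₆)).map fun f =>
        formValue (edgeForms (f.1.1.toNat + 2 * f.1.2.toNat)) (f.2.1.1.toNat + 2 * f.2.1.2.toNat)
          (f.2.2.1.toNat + 2 * f.2.2.2.toNat)).sum ≤ (48 : ℤ) := by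
  decide +kernel

theorem edge_certificate (c : (Fin 3 → Bool) → Bool) :
    (if ∑ u, (c u).toNat = 2 then ((54 : ℕ) : ℤ) else 0) +
      (edgePlacements.map fun γ => cornerValue edgeKernel fun u => c (place γ.1 γ.2 u)).sum ≤
        (48 : ℕ) := by
  obtain ⟨b, rfl⟩ := exists_eq_comp_ofBits c
  rw [sum_comp_ofBits fun k => (b k).toNat, sum_edge_cornerValue]
  have := edge_inequality (b 0) (b 1) (b 2) (b 3) (b 4) (b 5) (b 6) (b 7)
  simpa [Finset.sum_range_succ, ringCorners, edgeCodeAt] using this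

theorem injective_of_mem_edgePlacements : ∀ γ ∈ edgePlacements, Function.Injective γ.2 := by
  intro γ hγ
  simp only [edgePlacements, ringPlacements, List.mem_append, List.mem_cons,
    List.not_mem_nil, or_false] at hγ
  rcases hγ with ((h | h | h | h) | h | h | h | h) | h | h | h | h <;> subst h <;> decide

/-! ### Kernels on coloured squares -/

/-- The number of a coloured square. -/
def squareCode (F : (Fin 2 → Bool) → Bool) : ℕ :=
  (F ![false, false]).toNat + 2 * (F ![true, false]).toNat + 4 * (F ![false, true]).toNat +
    8 * (F ![true, true]).toNat

/-- The effect of the reflection in the first direction on the number of a coloured square. -/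
def mirrorFst (a : ℕ) : ℕ := 2 * (a % 2) + a / 2 % 2 + 8 * (a / 4 % 2) + 4 * (a / 8)

/-- The effect of the reflection in the second direction on the number of a coloured square. -/
def mirrorSnd (a : ℕ) : ℕ := a / 4 + 4 * (a % 4)

/-- Forms with relabelled arguments. -/
def reindexForms (p : ℕ → ℕ) (L : List (ℕ × List ℤ)) : List (ℕ × List ℤ) :=
  L.map fun q => (q.1, (List.range 16).map fun a => q.2.getD (p a) 0)

/-- The forms for squares with a given colouring, made from the forms `L₀` for empty squares,
`L₁` for squares with one point and `L₂` for squares with two opposite points. -/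
def squareForms (L₀ L₁ L₂ : List (ℕ × List ℤ)) : ℕ → List (ℕ × List ℤ)
  | 0 => L₀
  | 1 => L₁
  | 2 => reindexForms mirrorFst L₁
  | 4 => reindexForms mirrorSnd L₁
  | 6 => reindexForms mirrorFst L₂
  | 8 => reindexForms (fun a => mirrorFst (mirrorSnd a)) L₁
  | 9 => L₂
  | _ => []

/-- The kernel on coloured squares with given forms. -/
def squareKernel (forms : ℕ → List (ℕ × List ℤ)) (σ F F' : (Fin 2 → Bool) → Bool) : ℤ :=
  formValue (forms (squareCode σ)) (squareCode F) (squareCode F')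

theorem isPosKernel_squareKernel (forms : ℕ → List (ℕ × List ℤ)) (σ : (Fin 2 → Bool) → Bool) :
    IsPosKernel (squareKernel forms σ) := (isPosKernel_formValue _).comp squareCode

/-- The placements around the squares of the four-dimensional cube. -/
def squarePlacements : List ((Fin 4 → Bool) × (Fin 4 → Fin 4)) :=
  ringPlacements 2 3 ![0, 1] ++ ringPlacements 1 3 ![0, 2] ++ ringPlacements 1 2 ![0, 3] ++
    ringPlacements 0 3 ![1, 2] ++ ringPlacements 0 2 ![1, 3] ++ ringPlacements 0 1 ![2, 3]

/-- The vertex numbers of a square of a placed four-dimensional cube. -/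
def squareVertices (γ : (Fin 4 → Bool) × (Fin 4 → Fin 4)) (p q : Bool) : ℕ × ℕ × ℕ × ℕ :=
  (Nat.ofBits (place γ.1 γ.2 ![p, q, false, false]), Nat.ofBits (place γ.1 γ.2 ![p, q, true, false]),
    Nat.ofBits (place γ.1 γ.2 ![p, q, false, true]), Nat.ofBits (place γ.1 γ.2 ![p, q, true, true]))

/-- The squares of the four-dimensional cube, each followed by two of its neighbours. -/
def squareCorners : List ((ℕ × ℕ × ℕ × ℕ) × (ℕ × ℕ × ℕ × ℕ) × ℕ × ℕ × ℕ × ℕ) :=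
  ringCorners (0, 1, 2, 3) (4, 5, 6, 7) (12, 13, 14, 15) (8, 9, 10, 11) ++
  ringCorners (0, 1, 4, 5) (2, 3, 6, 7) (10, 11, 14, 15) (8, 9, 12, 13) ++
  ringCorners (0, 1, 8, 9) (2, 3, 10, 11) (6, 7, 14, 15) (4, 5, 12, 13) ++
  ringCorners (0, 2, 4, 6) (1, 3, 5, 7) (9, 11, 13, 15) (8, 10, 12, 14) ++
  ringCorners (0, 2, 8, 10) (1, 3, 9, 11) (5, 7, 13, 15) (4, 6, 12, 14) ++
  ringCorners (0, 4, 8, 12) (1, 5, 9, 13) (3, 7, 11, 15) (2, 6, 10, 14)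

theorem squareVertices_placements :
    squarePlacements.map (fun γ => (squareVertices γ false false, squareVertices γ true false,
      squareVertices γ false true)) = squareCorners := by
  decide +kernel

theorem injective_of_mem_squarePlacements :
    ∀ γ ∈ squarePlacements, Function.Injective γ.2 := by
  intro γ hγ
  simp only [squarePlacements, ringPlacements, List.mem_append, List.mem_cons,
    List.not_mem_nil, or_false] at hγ
  rcases hγ with (((((h | h | h | h) | h | h | h | h) | h | h | h | h) | h | h | h | h) |
    h | h | h | h) | h | h | h | h <;> subst h <;> decide

/-- The number of a coloured square with given vertex numbers. -/
def squareCodeAt (b : ℕ → Bool) (f : ℕ × ℕ × ℕ × ℕ) : ℕ :=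
  (b f.1).toNat + 2 * (b f.2.1).toNat + 4 * (b f.2.2.1).toNat + 8 * (b f.2.2.2).toNat

theorem squareCodeAt_lt (b : ℕ → Bool) (f : ℕ × ℕ × ℕ × ℕ) : squareCodeAt b f < 16 := by
  unfold squareCodeAt
  have h := fun k => Bool.toNat_le (b k)
  have h1 := h f.1
  have h2 := h f.2.1
  have h3 := h f.2.2.1
  have h4 := h f.2.2.2
  omega

theorem sum_square_cornerValue (forms : ℕ → List (ℕ × List ℤ)) (b : ℕ → Bool) :
    (squarePlacements.map fun γ => cornerValue (squareKernel forms) fun u =>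
      b (Nat.ofBits (place γ.1 γ.2 u))).sum =
    (squareCorners.map fun f => formValue (forms (squareCodeAt b f.1)) (squareCodeAt b f.2.1)
      (squareCodeAt b f.2.2)).sum := by
  rw [← squareVertices_placements, List.map_map]
  rfl

/-! ### Searching all colourings of the four-dimensional cube

The search evaluates natural number literals only; `withValue` makes the kernel evaluate an argument
before it is substituted. -/

/-- Application of `k` to `n`, where `n` is evaluated first. -/
def withValue {α : Type} (n : ℕ) (k : ℕ → α) : α :=
  Nat.rec (motive := fun _ => α) (k 0) (fun p _ => k p) (Nat.succ n)

theorem withValue_eq {α : Type} (n : ℕ) (k : ℕ → α) : withValue n k = k n := rfl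

/-- The numbers `v o, …, v (o + 2 ^ k - 1)` as the digits of one number in base `2 ^ 32`. -/
def packed (v : ℕ → ℕ) : ℕ → ℕ → ℕ
  | 0, o => v o
  | k + 1, o => packed v k o + 2 ^ (32 * 2 ^ k) * packed v k (o + 2 ^ k)

theorem packed_lt {v : ℕ → ℕ} (hv : ∀ i, v i < 2 ^ 32) (k o : ℕ) :
    packed v k o < 2 ^ (32 * 2 ^ k) := by
  induction k generalizing o with
  | zero => simpa [packed] using hv o
  | succ k ih =>
    have h1 := ih o
    have h2 := ih (o + 2 ^ k)
    have h3 : 2 ^ (32 * 2 ^ (k + 1)) = 2 ^ (32 * 2 ^ k) * 2 ^ (32 * 2 ^ k) := by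
      rw [← pow_add]; congr 1; ring
    rw [packed, h3]
    nlinarith

theorem packed_digit {v : ℕ → ℕ} (hv : ∀ i, v i < 2 ^ 32) (k o i : ℕ) (hi : i < 2 ^ k) :
    packed v k o / 2 ^ (i * 32) % 2 ^ 32 = v (o + i) := by
  induction k generalizing o i with
  | zero =>
    obtain rfl : i = 0 := by simpa using hi
    simpa [packed] using hv o
  | succ k ih =>
    have hlt := packed_lt hv k o
    rw [packed]
    rcases lt_or_ge i (2 ^ k) with h | h
    · rw [← ih o i h]
      have : 2 ^ (32 * 2 ^ k) = 2 ^ (i * 32) * (2 ^ 32 * 2 ^ (32 * (2 ^ k - i - 1))) := by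
        rw [← pow_add, ← pow_add]; congr 1; omega
      rw [this, mul_assoc (2 ^ (i * 32)), Nat.add_mul_div_left _ _ (by positivity), mul_assoc,
        Nat.add_mul_mod_self_left]
    · obtain ⟨j, rfl⟩ := Nat.exists_eq_add_of_le h
      have hj : j < 2 ^ k := by rw [pow_succ] at hi; omega
      rw [← add_assoc, ← ih (o + 2 ^ k) j hj, add_mul, pow_add, mul_comm (2 ^ k) 32,
        ← Nat.div_div_eq_div_mul, Nat.add_mul_div_left _ _ (by positivity),
        Nat.div_eq_of_lt hlt, zero_add]

/-- The digit of `T` at position `i` in base `2 ^ 32`. -/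
def digitAt (T i : ℕ) : ℕ := Nat.mod (Nat.shiftRight T (Nat.mul i 32)) 4294967296

/-- The digit of `T` whose position is the number at bits `j, …, j + 11` of `x`. -/
def lookUp (T x j : ℕ) : ℕ := withValue (Nat.mod (Nat.shiftRight x j) 4096) (digitAt T)

/-- The sum of the digits of `T` at four positions read off from `r`. -/
def lookUpSum (T r : ℕ) : ℕ :=
  Nat.add (Nat.add (lookUp T r 0) (lookUp T r 4)) (Nat.add (lookUp T r 8) (lookUp T r 12))

/-- The sum of `lookUpSum` over the two last digits of `x` in base `2 ^ 24`. -/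
def pairSum (T x : ℕ) : ℕ :=
  Nat.add (withValue (Nat.mod x 16777216) (lookUpSum T))
    (withValue (Nat.mod (Nat.shiftRight x 24) 16777216) (lookUpSum T))

/-- The inequality for one colouring, which is given by three numbers. -/
def leafCheck (T A s B x y z : ℕ) : Bool :=
  Nat.ble (Nat.add (cond (Nat.beq (Nat.shiftRight x 48) s) A 0)
    (Nat.add (pairSum T x) (Nat.add (pairSum T y) (pairSum T z)))) B

/-- The inequality for all colourings, where each list entry is the contribution of one vertex. -/
noncomputable def treeCheck (T A s B : ℕ) (ws : List (ℕ × ℕ × ℕ)) : ℕ → ℕ → ℕ → Bool :=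
  List.rec (motive := fun _ => ℕ → ℕ → ℕ → Bool) (fun x y z => leafCheck T A s B x y z)
    (fun w _ ih x y z => and (ih x y z) (withValue (Nat.add x w.1) fun x =>
      withValue (Nat.add y w.2.1) fun y => withValue (Nat.add z w.2.2) fun z => ih x y z)) ws

/-- The sum of the entries of `ws` selected by `bs`. -/
def selectedSum (bs : List Bool) (ws : List ℕ) : ℕ :=
  (List.zipWith (fun b w => w * Bool.toNat b) bs ws).sum

/-- A list of bits is a path in the binary search tree, and the selected weights accumulate along
it. -/
theorem leafCheck_of_treeCheck {T A s B : ℕ} {ws : List (ℕ × ℕ × ℕ)} {x y z : ℕ}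
    (h : treeCheck T A s B ws x y z = true) (bs : List Bool) (hbs : bs.length = ws.length) :
    leafCheck T A s B (x + selectedSum bs (ws.map fun w => w.1))
      (y + selectedSum bs (ws.map fun w => w.2.1))
      (z + selectedSum bs (ws.map fun w => w.2.2)) = true := by
  induction ws generalizing x y z bs with
  | nil =>
    have h' : leafCheck T A s B x y z = true := h
    simpa [selectedSum] using h'
  | cons w ws ih =>
    cases bs with
    | nil => simp at hbs
    | cons b bs =>
      have hbs' : bs.length = ws.length := by simpa using hbs
      have h' : treeCheck T A s B ws x y z = true ∧
          treeCheck T A s B ws (x + w.1) (y + w.2.1) (z + w.2.2) = true :=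
        Bool.and_eq_true_iff.1 h
      cases b with
      | false => simpa [selectedSum] using ih h'.1 bs hbs'
      | true => simpa [selectedSum, add_assoc] using ih h'.2 bs hbs'

/-- The numbers of four cyclically arranged squares, the first two repeated, as digits. -/
def ringNumber (a b c e : ℕ) : ℕ :=
  a + 16 * b + 256 * c + 4096 * e + 65536 * a + 1048576 * b

/-- The contributions of the vertices to the numbers that describe a colouring. -/
def vertexWeights : List (ℕ × ℕ × ℕ) :=
  -- Each component holds two ring numbers in 24-bit blocks, and the first also counts points from
  -- bit 48 on. All are linear in the vertex indicators, hence sums of vertex contributions.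
  [(282574505181185, 1099528470529, 1099528470529),
   (283674033651714, 17592454610946, 17592455528464),
   (299067431452676, 2199057858576, 68719607810),
   (316659886194696, 35184911056928, 4297064480),
   (285873091379216, 4398113624064, 2199056814080),
   (290271206047776, 70369817927680, 35184908960000),
   (351844798824512, 8796227240192, 137438961664),
   (422214620938368, 140739635839488, 8589935104),
   (281543696191488, 68719738884, 4398113882116),
   (281612415672320, 4295491592, 70369822113856),
   (281479271694336, 137443147840, 274878431240),
   (281483566678016, 8598323328, 17188257920),
   (281749854617856, 274877923328, 8796227256320),
   (282024732525056, 17179901952, 140739635840000),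
   (281492156580864, 549755814912, 549755846656),
   (281509336451072, 34359740416, 34359740416)]

/-- The entry of the table of values of a form, shifted by `o` to make it nonnegative. -/
def tableEntry (forms : ℕ → List (ℕ × List ℤ)) (o i : ℕ) : ℕ :=
  (formValue (forms (i / 16 % 16)) (i % 16) (i / 256) + (o : ℤ)).toNat % 2 ^ 32

/-- The numerical check of the inequality for all colourings of the four-dimensional cube. -/
noncomputable def cubeCheck (forms : ℕ → List (ℕ × List ℤ)) (o A s B : ℕ) : Bool :=
  withValue (packed (tableEntry forms o) 12 0) fun T =>
    -- Six rings of four corners, each table value shifted by `o`.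
    treeCheck T A s (B + 24 * o) vertexWeights 0 0 0

/-- All values of the forms are in the range of the table. -/
def InRange (forms : ℕ → List (ℕ × List ℤ)) (o : ℕ) : Prop :=
  ∀ a b c : Fin 16, 0 ≤ formValue (forms b) a c + (o : ℤ) ∧
    formValue (forms b) a c + (o : ℤ) < 4294967296

/-- The middle base-16 digit is the central square, the outer two its neighbours. The range
condition makes truncation and reduction mod 2^32 harmless. -/
theorem tableEntry_eq {forms : ℕ → List (ℕ × List ℤ)} {o : ℕ} (h : InRange forms o)
    {a b c : ℕ} (ha : a < 16) (hb : b < 16) (hc : c < 16) :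
    ((tableEntry forms o (a + 16 * b + 256 * c) : ℕ) : ℤ) = formValue (forms b) a c + o := by
  have h1 := h ⟨a, ha⟩ ⟨b, hb⟩ ⟨c, hc⟩
  simp only at h1
  unfold tableEntry
  have e1 : (a + 16 * b + 256 * c) / 16 % 16 = b := by omega
  have e2 : (a + 16 * b + 256 * c) % 16 = a := by omega
  have e3 : (a + 16 * b + 256 * c) / 256 = c := by omega
  rw [e1, e2, e3]
  omega

theorem lookUp_packed {v : ℕ → ℕ} (hv : ∀ i, v i < 2 ^ 32) (x j : ℕ) :
    lookUp (packed v 12 0) x j = v (x / 2 ^ j % 4096) := by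
  have := packed_digit hv 12 0 (x / 2 ^ j % 4096) (Nat.mod_lt _ (by norm_num))
  rw [zero_add] at this
  rw [← this, ← Nat.shiftRight_eq_div_pow, ← Nat.shiftRight_eq_div_pow]
  rfl

/-- The values of a table at the four corners of a ring. -/
def ringValue (v : ℕ → ℕ) (a b c e : ℕ) : ℕ :=
  v (a + 16 * b + 256 * c) + v (b + 16 * c + 256 * e) +
    (v (c + 16 * e + 256 * a) + v (e + 16 * a + 256 * b))

theorem div_mod_of_eq {x P r w h : ℕ} (hx : x = r + P * (w + 4096 * h)) (hr : r < P)
    (hw : w < 4096) : x / P % 4096 = w := by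
  rw [hx, Nat.add_mul_div_left _ _ (by omega), Nat.div_eq_of_lt hr]
  omega

/-- Since the first two of the four digits are repeated at the end, the 12-bit windows at bits 0, 4,
8, 12 are the four cyclic triples. -/
theorem lookUpSum_ringNumber {T : ℕ} {v : ℕ → ℕ}
    (hT : ∀ x j, lookUp T x j = v (x / 2 ^ j % 4096)) {a b c e : ℕ} (ha : a < 16)
    (hb : b < 16) (hc : c < 16) (he : e < 16) :
    lookUpSum T (ringNumber a b c e) = ringValue v a b c e := by
  show lookUp _ _ _ + lookUp _ _ _ + (lookUp _ _ _ + lookUp _ _ _) = _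
  simp only [hT, ringValue, ringNumber]
  rw [div_mod_of_eq (r := 0) (w := a + 16 * b + 256 * c) (h := e + 16 * a + 256 * b),
    div_mod_of_eq (r := a) (w := b + 16 * c + 256 * e) (h := a + 16 * b),
    div_mod_of_eq (r := a + 16 * b) (w := c + 16 * e + 256 * a) (h := b),
    div_mod_of_eq (r := a + 16 * b + 256 * c) (w := e + 16 * a + 256 * b) (h := 0)] <;> omega

theorem ringNumber_lt {a b c e : ℕ} (ha : a < 16) (hb : b < 16) (hc : c < 16) (he : e < 16) :
    ringNumber a b c e < 16777216 := by
  unfold ringNumber; omega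

theorem pairSum_eq (T : ℕ) {r r' : ℕ} (hr : r < 16777216) (hr' : r' < 16777216) (h : ℕ) :
    pairSum T (r + 16777216 * (r' + 16777216 * h)) = lookUpSum T r + lookUpSum T r' := by
  have h1 : (r + 16777216 * (r' + 16777216 * h)) % 16777216 = r := by omega
  have h2 : (r + 16777216 * (r' + 16777216 * h)) >>> 24 % 16777216 = r' := by
    rw [Nat.shiftRight_eq_div_pow]; omega
  show lookUpSum T (_ % 16777216) + lookUpSum T (_ >>> 24 % 16777216) = _
  rw [h1, h2]

theorem cast_ringValue {forms : ℕ → List (ℕ × List ℤ)} {v : ℕ → ℕ} {o : ℕ}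
    (hv : ∀ a < 16, ∀ b < 16, ∀ c < 16,
      ((v (a + 16 * b + 256 * c) : ℕ) : ℤ) = formValue (forms b) a c + o)
    {a b c e : ℕ} (ha : a < 16) (hb : b < 16) (hc : c < 16) (he : e < 16) :
    ((ringValue v a b c e : ℕ) : ℤ) =
      ((ringCorners a b c e).map fun f => formValue (forms f.1) f.2.1 f.2.2).sum + 4 * o := by
  unfold ringValue ringCorners
  push_cast
  rw [hv a ha b hb c hc, hv b hb c hc e he, hv c hc e he a ha, hv e he a ha b hb]
  simp
  ring

/-- A successful search in a table of values implies the inequality for each colouring. -/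
theorem inequality_of_treeCheck {forms : ℕ → List (ℕ × List ℤ)} {v : ℕ → ℕ} {T o A s B : ℕ}
    (hT : ∀ x j, lookUp T x j = v (x / 2 ^ j % 4096))
    (hv : ∀ a < 16, ∀ b < 16, ∀ c < 16,
      ((v (a + 16 * b + 256 * c) : ℕ) : ℤ) = formValue (forms b) a c + o)
    (hcheck : treeCheck T A s (B + 24 * o) vertexWeights 0 0 0 = true)
    (c : (Fin 4 → Bool) → Bool) :
    (if ∑ u, (c u).toNat = s then (A : ℤ) else 0) + (squarePlacements.map fun γ =>
      cornerValue (squareKernel forms) fun u => c (place γ.1 γ.2 u)).sum ≤ B := by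
  obtain ⟨b, rfl⟩ := exists_eq_comp_ofBits c
  rw [sum_comp_ofBits fun k => (b k).toNat, sum_square_cornerValue]
  have hleaf := leafCheck_of_treeCheck hcheck ((List.range 16).map b) (by simp [vertexWeights])
  set N := ∑ k ∈ Finset.range (2 ^ 4), (b k).toNat with hN
  rw [show (2 : ℕ) ^ 4 = 16 from rfl] at hN
  simp only [Finset.sum_range_succ, Finset.sum_range_zero] at hN
  set q : ℕ → ℕ → ℕ → ℕ → ℕ := fun i j k l => squareCodeAt b (i, j, k, l) with hq
  have hx : 0 + selectedSum ((List.range 16).map b) (vertexWeights.map fun w => w.1) =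
      ringNumber (q 0 1 2 3) (q 4 5 6 7) (q 12 13 14 15) (q 8 9 10 11) + 16777216 *
        (ringNumber (q 0 1 4 5) (q 2 3 6 7) (q 10 11 14 15) (q 8 9 12 13) + 16777216 * N) := by
    simp only [hN, hq, selectedSum, vertexWeights,
      List.range_succ, List.range_zero, List.map, List.zipWith, List.sum_cons, List.sum_nil,
      List.nil_append, List.cons_append, ringNumber, squareCodeAt]
    ring
  have hy : 0 + selectedSum ((List.range 16).map b) (vertexWeights.map fun w => w.2.1) =
      ringNumber (q 0 1 8 9) (q 2 3 10 11) (q 6 7 14 15) (q 4 5 12 13) + 16777216 *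
        (ringNumber (q 0 2 4 6) (q 1 3 5 7) (q 9 11 13 15) (q 8 10 12 14) + 16777216 * 0) := by
    simp only [hq, selectedSum, vertexWeights,
      List.range_succ, List.range_zero, List.map, List.zipWith, List.sum_cons, List.sum_nil,
      List.nil_append, List.cons_append, ringNumber, squareCodeAt]
    ring
  have hz : 0 + selectedSum ((List.range 16).map b) (vertexWeights.map fun w => w.2.2) =
      ringNumber (q 0 2 8 10) (q 1 3 9 11) (q 5 7 13 15) (q 4 6 12 14) + 16777216 *
        (ringNumber (q 0 4 8 12) (q 1 5 9 13) (q 3 7 11 15) (q 2 6 10 14) + 16777216 * 0) := by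
    simp only [hq, selectedSum, vertexWeights,
      List.range_succ, List.range_zero, List.map, List.zipWith, List.sum_cons, List.sum_nil,
      List.nil_append, List.cons_append, ringNumber, squareCodeAt]
    ring
  have hlt : ∀ i j k l, q i j k l < 16 := fun i j k l => squareCodeAt_lt b _
  rw [hx, hy, hz] at hleaf
  have hcount : Nat.shiftRight
      (ringNumber (q 0 1 2 3) (q 4 5 6 7) (q 12 13 14 15) (q 8 9 10 11) + 16777216 *
        (ringNumber (q 0 1 4 5) (q 2 3 6 7) (q 10 11 14 15) (q 8 9 12 13) + 16777216 * N)) 48 =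
      N := by
    have h1 := ringNumber_lt (hlt 0 1 2 3) (hlt 4 5 6 7) (hlt 12 13 14 15) (hlt 8 9 10 11)
    have h2 := ringNumber_lt (hlt 0 1 4 5) (hlt 2 3 6 7) (hlt 10 11 14 15) (hlt 8 9 12 13)
    rw [show ∀ x y, Nat.shiftRight x y = x >>> y from fun _ _ => rfl, Nat.shiftRight_eq_div_pow]
    omega
  have hle := Nat.le_of_ble_eq_true hleaf
  simp only [hcount, pairSum_eq T
    (ringNumber_lt (hlt _ _ _ _) (hlt _ _ _ _) (hlt _ _ _ _) (hlt _ _ _ _))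
    (ringNumber_lt (hlt _ _ _ _) (hlt _ _ _ _) (hlt _ _ _ _) (hlt _ _ _ _)),
    lookUpSum_ringNumber hT (hlt _ _ _ _) (hlt _ _ _ _) (hlt _ _ _ _) (hlt _ _ _ _)] at hle
  simp only [Nat.add_eq] at hle
  zify at hle
  simp only [cast_ringValue hv (hlt _ _ _ _) (hlt _ _ _ _) (hlt _ _ _ _) (hlt _ _ _ _)] at hle
  have hcond : ((cond (N.beq s) A 0 : ℕ) : ℤ) = if N = s then (A : ℤ) else 0 := by
    by_cases h : N = s
    · simp [h]
    · have : N.beq s = false := by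
        rw [Bool.eq_false_iff]; exact fun h' => h (Nat.eq_of_beq_eq_true h')
      simp [h, this]
  rw [hcond] at hle
  have hsum : (squareCorners.map fun f => formValue (forms (squareCodeAt b f.1))
      (squareCodeAt b f.2.1) (squareCodeAt b f.2.2)).sum =
      ((ringCorners (q 0 1 2 3) (q 4 5 6 7) (q 12 13 14 15) (q 8 9 10 11)).map fun f =>
        formValue (forms f.1) f.2.1 f.2.2).sum +
      ((ringCorners (q 0 1 4 5) (q 2 3 6 7) (q 10 11 14 15) (q 8 9 12 13)).map fun f =>
        formValue (forms f.1) f.2.1 f.2.2).sum +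
      ((ringCorners (q 0 1 8 9) (q 2 3 10 11) (q 6 7 14 15) (q 4 5 12 13)).map fun f =>
        formValue (forms f.1) f.2.1 f.2.2).sum +
      ((ringCorners (q 0 2 4 6) (q 1 3 5 7) (q 9 11 13 15) (q 8 10 12 14)).map fun f =>
        formValue (forms f.1) f.2.1 f.2.2).sum +
      ((ringCorners (q 0 2 8 10) (q 1 3 9 11) (q 5 7 13 15) (q 4 6 12 14)).map fun f =>
        formValue (forms f.1) f.2.1 f.2.2).sum +
      ((ringCorners (q 0 4 8 12) (q 1 5 9 13) (q 3 7 11 15) (q 2 6 10 14)).map fun f =>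
        formValue (forms f.1) f.2.1 f.2.2).sum := by
    simp only [squareCorners, List.map_append, List.sum_append]
    rfl
  rw [hsum]
  linarith

/-- The numerical check implies the inequality for each colouring. -/
theorem square_certificate {forms : ℕ → List (ℕ × List ℤ)} {o A s B : ℕ} (hr : InRange forms o)
    (hcheck : cubeCheck forms o A s B = true) (c : (Fin 4 → Bool) → Bool) :
    (if ∑ u, (c u).toNat = s then (A : ℤ) else 0) + (squarePlacements.map fun γ =>
      cornerValue (squareKernel forms) fun u => c (place γ.1 γ.2 u)).sum ≤ B := by
  rw [cubeCheck, withValue_eq] at hcheck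
  exact inequality_of_treeCheck (lookUp_packed fun i => Nat.mod_lt _ (by norm_num))
    (fun a ha b hb c hc => tableEntry_eq hr ha hb hc) hcheck c

/-! ### Certificates for the four-dimensional cube -/

/-- The forms for exactly four points in a four-dimensional cube. -/
def fourPointForms : ℕ → List (ℕ × List ℤ) :=
  squareForms
    -- Again every vector has mean 0 on the extremal code, here with k = 2. Neighbour codes are
    -- uniform on 0, 6, 9 for an empty square and on 2, 4, 8 for one point; for two opposite points
    -- they are 0 with probability 2/3 and 6 with probability 1/3.
    [(13, [4, 3, 3, -2, 3, -2, -2, 0, 3, -2, -2, 0, -2, 0, 0, 0]),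
     (40, [0, 0, 0, 0, 0, 0, 1, 0, 0, -1, 0, 0, 0, 0, 0, 0])]
    [(20, [0, 2, 1, 2, 1, 2, 2, 0, -2, 0, -3, 0, -3, 0, -2, 0]),
     (260, [1, 0, 0, -1, 0, -1, -1, 0, 0, 0, -1, 0, -1, 0, -1, 1]),
     (68, [0, 0, 1, 0, -1, 0, 0, 0, 0, 0, 0, 0, 0, 0, 0, 0])]
    [(52, [1, 0, 0, 0, 0, 0, -2, 0, 0, 0, 0, 0, 0, 0, 0, 0])]

/-- The forms for exactly two points in a four-dimensional cube. -/
def twoPointForms : ℕ → List (ℕ × List ℤ) :=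
  squareForms
    -- Mean 0 on the code with k = 3. For an empty square, the seven neighbours have codes 1, 2, 4,
    -- 8 once and 0 three times if the two direction vectors differ, and 6, 9 once and 0 five times
    -- if they agree. For one point they are 2, 4, 8 once and 0 four times; for two opposite points,
    -- 6 once and 0 six times.
    [(1782, [4, -3, -3, 0, -3, 0, -10, 0, -3, -10, 0, 0, 0, 0, 0, 0]),
     (5873, [0, -1, 1, 0, 1, 0, 4, 0, -1, -4, 0, 0, 0, 0, 0, 0]),
     (17332, [0, 1, -1, 0, -1, 0, 0, 0, 1, 0, 0, 0, 0, 0, 0, 0]),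
     (73038, [0, 1, 0, 0, 0, 0, 0, 0, -1, 0, 0, 0, 0, 0, 0, 0]),
     (73038, [0, 0, 1, 0, -1, 0, 0, 0, 0, 0, 0, 0, 0, 0, 0, 0])]
    [(1859, [3, -5, -4, 0, -4, 0, 0, 0, -4, 0, 0, 0, 0, 0, 0, 0]),
     (5040, [0, 0, 1, 0, 1, 0, 0, 0, -2, 0, 0, 0, 0, 0, 0, 0]),
     (60256, [0, 0, 1, 0, -1, 0, 0, 0, 0, 0, 0, 0, 0, 0, 0, 0])]
    [(792, [1, 0, 0, 0, 0, 0, -6, 0, 0, 0, 0, 0, 0, 0, 0, 0])]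

theorem inRange_fourPointForms : InRange fourPointForms 260 := by
  unfold InRange
  decide +kernel

theorem inRange_twoPointForms : InRange twoPointForms 71280 := by
  unfold InRange
  decide +kernel

theorem cubeCheck_fourPointForms : cubeCheck fourPointForms 260 5184 4 4992 = true := by
  decide +kernel

theorem cubeCheck_twoPointForms : cubeCheck twoPointForms 71280 889056 2 684288 = true := by
  decide +kernel

/-! ### Lower bounds from linear codes -/

section Lower

variable {n d : ℕ} {V : Type*} [AddCommGroup V]

/-- The sum of the vectors `a t` over the support of `x`. -/
def supportSum (a : Fin n → V) (x : Fin n → Bool) : V := ∑ t, if x t = true then a t else 0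

theorem supportSum_xor (hV : ∀ v : V, v + v = 0) (a : Fin n → V) (x y : Fin n → Bool) :
    supportSum a (fun t => xor (x t) (y t)) = supportSum a x + supportSum a y := by
  unfold supportSum
  rw [← Finset.sum_add_distrib]
  refine Finset.sum_congr rfl fun t _ => ?_
  generalize hx : x t = p
  generalize hy : y t = q
  cases p <;> cases q <;> simp [hx, hy, hV]

theorem supportSum_place (hV : ∀ v : V, v + v = 0) (a : Fin n → V) (x : Fin n → Bool)
    {e : Fin d → Fin n} (he : Function.Injective e) (u : Fin d → Bool) :
    supportSum a (place x e u) = supportSum a x + supportSum (a ∘ e) u := by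
  classical
  have h : supportSum a (fun t => decide (∃ i, e i = t ∧ u i = true)) =
      supportSum (a ∘ e) u := by
    unfold supportSum
    simp only [decide_eq_true_eq]
    rw [← Finset.sum_filter, ← Finset.sum_filter]
    have : (Finset.univ.filter fun t => ∃ i, e i = t ∧ u i = true) =
        (Finset.univ.filter fun i => u i = true).image e := by
      ext t
      simp only [Finset.mem_filter, Finset.mem_univ, true_and, Finset.mem_image]
      exact ⟨fun ⟨i, h1, h2⟩ => ⟨i, h2, h1⟩, fun ⟨i, h1, h2⟩ => ⟨i, h2, h1⟩⟩
    rw [this, Finset.sum_image fun i _ j _ hij => he hij]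
    rfl
  rw [← h]
  exact supportSum_xor hV a x _

theorem supportSum_single (b : Fin d → V) (i : Fin d) :
    supportSum b (fun j => decide (j = i)) = b i := by
  simp [supportSum]

theorem supportSum_zero (b : Fin d → V) : supportSum b (fun _ => false) = 0 := by
  simp [supportSum]

variable [Fintype V] [DecidableEq V]

/-- The code with parity check vectors `a`. -/
def codeSet (a : Fin n → V) : Finset (Fin n → Bool) :=
  Finset.univ.filter fun x => supportSum a x = 0

/-- Fibres of a surjective homomorphism are translates of one another. -/
theorem card_fiber_supportSum (hV : ∀ v : V, v + v = 0) {b : Fin d → V}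
    (hb : Function.Surjective (supportSum b)) (w : V) :
    (Finset.univ.filter fun u => supportSum b u = w).card * Fintype.card V = 2 ^ d := by
  classical
  have hconst : ∀ w' : V, (Finset.univ.filter fun u => supportSum b u = w').card =
      (Finset.univ.filter fun u => supportSum b u = w).card := by
    intro w'
    obtain ⟨z, hz⟩ := hb (w' + w)
    refine Finset.card_nbij' (fun u i => xor (u i) (z i)) (fun u i => xor (u i) (z i))
      ?_ ?_ ?_ ?_
    · intro u hu
      simp only [Finset.coe_filter, Finset.mem_univ, true_and, Set.mem_ofPred_eq] at hu ⊢
      rw [supportSum_xor hV, hu, hz, ← add_assoc, hV, zero_add]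
    · intro u hu
      simp only [Finset.coe_filter, Finset.mem_univ, true_and, Set.mem_ofPred_eq] at hu ⊢
      rw [supportSum_xor hV, hu, hz, add_comm w', ← add_assoc, hV, zero_add]
    · intro u _; funext i; simp
    · intro u _; funext i; simp
  have htotal := Finset.card_eq_sum_card_fiberwise (f := supportSum b)
    (s := (Finset.univ : Finset (Fin d → Bool))) (t := Finset.univ) (fun _ _ => by simp)
  rw [Finset.sum_congr rfl fun w' _ => hconst w', Finset.sum_const, smul_eq_mul] at htotal
  simpa [mul_comm] using htotal.symm

theorem pointCount_codeSet (hV : ∀ v : V, v + v = 0) (a : Fin n → V) (x : Fin n → Bool)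
    {e : Fin d → Fin n} (he : Function.Injective e)
    (hs : Function.Surjective (supportSum (a ∘ e))) :
    pointCount (codeSet a) x e * Fintype.card V = 2 ^ d := by
  rw [← card_fiber_supportSum hV hs (supportSum a x)]
  unfold pointCount
  congr 2
  ext u
  simp only [codeSet, Finset.mem_filter, Finset.mem_univ, true_and, supportSum_place hV a x he]
  constructor
  · intro h
    rw [add_comm] at h
    rw [eq_neg_of_add_eq_zero_left h]
    exact neg_eq_of_add_eq_zero_left (hV _)
  · intro h
    rw [h, hV]

/-- If `a` is uniform, so is its restriction along an injective `e`. The bijection exchanges the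
entries of `a` on the range of `e` with `b`. -/
theorem card_filter_comp_mul {κ : Type*} [Fintype κ] {e : Fin d → Fin n}
    (he : Function.Injective e) (P : (Fin d → κ) → Prop) [DecidablePred P] :
    (Finset.univ.filter fun a : Fin n → κ => P (a ∘ e)).card * Fintype.card κ ^ d =
      (Finset.univ.filter P).card * Fintype.card κ ^ n := by
  classical
  have h1 : Fintype.card κ ^ d = (Finset.univ : Finset (Fin d → κ)).card := by simp
  have h2 : Fintype.card κ ^ n = (Finset.univ : Finset (Fin n → κ)).card := by simp
  rw [h1, h2, ← Finset.card_product, ← Finset.card_product]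
  have hext : ∀ (a : Fin n → κ) (b : Fin d → κ), Function.extend e b a ∘ e = b := fun a b =>
    funext fun i => he.extend_apply b a i
  have hback : ∀ (a : Fin n → κ) (b : Fin d → κ),
      Function.extend e (a ∘ e) (Function.extend e b a) = a := by
    intro a b
    funext t
    by_cases ht : ∃ i, e i = t
    · obtain ⟨i, rfl⟩ := ht
      rw [he.extend_apply]; rfl
    · rw [Function.extend_apply' _ _ _ ht, Function.extend_apply' _ _ _ ht]
  refine Finset.card_nbij' (fun q => (q.1 ∘ e, Function.extend e q.2 q.1))
    (fun q => (Function.extend e q.1 q.2, q.2 ∘ e)) ?_ ?_ ?_ ?_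
  · rintro ⟨a, b⟩ h
    simpa using h
  · rintro ⟨b, a⟩ h
    simpa [hext] using h
  · rintro ⟨a, b⟩ _
    simp only [hext, hback]
  · rintro ⟨b, a⟩ _
    simp only [hext, hback]

/-- Averaging over all choices of parity check vectors from the family `vec`. -/
theorem le_statisticsDensity_of_vectors {κ : Type*} [Fintype κ] [Nonempty κ] {s g : ℕ}
    (hV : ∀ v : V, v + v = 0) (hs : s * Fintype.card V = 2 ^ d) (vec : κ → V)
    (P : (Fin d → κ) → Prop) [DecidablePred P]
    (hP : ∀ b, P b → Function.Surjective (supportSum (vec ∘ b)))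
    (hg : g ≤ (Finset.univ.filter P).card) (hd : d ≤ n) :
    (g : ℝ) / Fintype.card κ ^ d ≤ statisticsDensity d s n := by
  classical
  set N : ℕ := Fintype.card κ with hN
  have hNpos : 0 < N := Fintype.card_pos
  set good : (Fin n → κ) → ℕ := fun a =>
    ((placements n d).filter fun q => pointCount (codeSet (vec ∘ a)) q.1 q.2 = s).card with hgood
  have hVpos : 0 < Fintype.card V := Fintype.card_pos
  have hmem : ∀ (a : Fin n → κ) (q : (Fin n → Bool) × (Fin d → Fin n)), q ∈ placements n d →
      P (a ∘ q.2) → pointCount (codeSet (vec ∘ a)) q.1 q.2 = s := by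
    intro a q hq hPa
    have := pointCount_codeSet hV (vec ∘ a) q.1 (mem_placements.1 hq) (hP _ hPa)
    exact Nat.eq_of_mul_eq_mul_right hVpos (this.trans hs.symm)
  have hcount : (placements n d).card * (g * N ^ n) ≤ (∑ a, good a) * N ^ d := by
    calc (placements n d).card * (g * N ^ n)
        = ∑ _q ∈ placements n d, g * N ^ n := by rw [Finset.sum_const, smul_eq_mul]
      _ ≤ ∑ q ∈ placements n d,
          (Finset.univ.filter fun a : Fin n → κ => P (a ∘ q.2)).card * N ^ d := by
        refine Finset.sum_le_sum fun q hq => ?_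
        rw [card_filter_comp_mul (mem_placements.1 hq) P]
        exact Nat.mul_le_mul_right _ hg
      _ = (∑ a : Fin n → κ, ((placements n d).filter fun q => P (a ∘ q.2)).card) * N ^ d := by
        rw [← Finset.sum_mul]
        congr 1
        simp only [Finset.card_filter]
        rw [Finset.sum_comm]
      _ ≤ (∑ a, good a) * N ^ d := by
        refine Nat.mul_le_mul_right _ (Finset.sum_le_sum fun a _ => Finset.card_le_card ?_)
        intro q hq
        rw [Finset.mem_filter] at hq ⊢
        exact ⟨hq.1, hmem a q hq.1 hq.2⟩
  -- Some choice of vectors is at least as good as the average over all `N ^ n`.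
  obtain ⟨a, ha⟩ : ∃ a, (placements n d).card * g ≤ good a * N ^ d := by
    by_contra! hlt
    have h1 : (∑ a, good a) * N ^ d < ∑ _a : Fin n → κ, (placements n d).card * g := by
      rw [Finset.sum_mul]
      exact Finset.sum_lt_sum_of_nonempty Finset.univ_nonempty fun a _ => hlt a
    rw [Finset.sum_const, Finset.card_univ, Fintype.card_fun, Fintype.card_fin, smul_eq_mul,
      ← hN] at h1
    have h2 : N ^ n * ((placements n d).card * g) = (placements n d).card * (g * N ^ n) := by ring
    omega
  refine le_statisticsDensity hd (codeSet (vec ∘ a)) ?_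
  rw [card_placements] at ha
  have ha' : ((2 : ℝ) ^ n * n.descFactorial d) * g ≤ good a * (N : ℝ) ^ d := by exact_mod_cast ha
  have hpos : (0 : ℝ) < (N : ℝ) ^ d := by positivity
  rw [div_mul_eq_mul_div, div_le_iff₀ hpos]
  linarith

end Lower

/-! ### Spanning vectors in dimensions two and three, and the three lower bounds -/

/-- The nonzero vectors of the plane over the field with two elements. -/
def planeVector (p : Fin 3) : ZMod 2 × ZMod 2 :=
  (((p.val + 1 : ℕ) : ZMod 2), (((p.val + 1) / 2 : ℕ) : ZMod 2))

theorem plane_eq_combination : ∀ p q : Fin 3, p ≠ q → ∀ v : ZMod 2 × ZMod 2,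
    v = 0 ∨ v = planeVector p ∨ v = planeVector q ∨ v = planeVector p + planeVector q := by
  decide +kernel

theorem surjective_planeVector {d : ℕ} (b : Fin d → Fin 3) {i j : Fin d} (h : b i ≠ b j) :
    Function.Surjective (supportSum (planeVector ∘ b)) := by
  have hV : ∀ v : ZMod 2 × ZMod 2, v + v = 0 := by decide
  intro v
  rcases plane_eq_combination _ _ h v with rfl | rfl | rfl | rfl
  · exact ⟨_, supportSum_zero _⟩
  · exact ⟨_, supportSum_single (planeVector ∘ b) i⟩
  · exact ⟨_, supportSum_single (planeVector ∘ b) j⟩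
  · exact ⟨_, (supportSum_xor hV _ _ _).trans
      (congrArg₂ _ (supportSum_single (planeVector ∘ b) i) (supportSum_single (planeVector ∘ b) j))⟩

/-- The nonzero vectors of the three-dimensional space over the field with two elements. -/
def spaceVector (p : Fin 7) : ZMod 2 × ZMod 2 × ZMod 2 :=
  (((p.val + 1 : ℕ) : ZMod 2), (((p.val + 1) / 2 : ℕ) : ZMod 2), (((p.val + 1) / 4 : ℕ) : ZMod 2))

/-- Linear independence of three of the vectors `spaceVector p`. -/
def independent (p q r : ℕ) : Bool :=
  !(Nat.beq p q || Nat.beq p r || Nat.beq q r ||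
    Nat.beq (Nat.xor (Nat.succ p) (Nat.succ q)) (Nat.succ r))

theorem space_eq_combination : ∀ p q r : Fin 7, independent p q r = true →
    ∀ v : ZMod 2 × ZMod 2 × ZMod 2, ∃ x y z : Bool, v =
      (if x then spaceVector p else 0) + ((if y then spaceVector q else 0) +
        (if z then spaceVector r else 0)) := by
  decide +kernel

theorem surjective_spaceVector {d : ℕ} (b : Fin d → Fin 7) {i j k : Fin d}
    (h : independent (b i) (b j) (b k) = true) :
    Function.Surjective (supportSum (spaceVector ∘ b)) := by
  have hV : ∀ v : ZMod 2 × ZMod 2 × ZMod 2, v + v = 0 := by decide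
  have hmul : ∀ (x : Bool) (i : Fin d), ∃ u, supportSum (spaceVector ∘ b) u =
      if x then spaceVector (b i) else 0 := by
    intro x i
    cases x
    · exact ⟨_, supportSum_zero _⟩
    · exact ⟨_, supportSum_single (spaceVector ∘ b) i⟩
  intro v
  obtain ⟨x, y, z, rfl⟩ := space_eq_combination _ _ _ h v
  obtain ⟨u₁, h₁⟩ := hmul x i
  obtain ⟨u₂, h₂⟩ := hmul y j
  obtain ⟨u₃, h₃⟩ := hmul z k
  refine ⟨fun t => xor (u₁ t) (xor (u₂ t) (u₃ t)), ?_⟩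
  rw [supportSum_xor hV _ u₁, supportSum_xor hV, h₁, h₂, h₃]

/-- Four of the vectors `spaceVector p` contain three independent ones. -/
def spanning (p q r t : ℕ) : Bool :=
  independent p q r || independent p q t || independent p r t || independent q r t

/-- 1848 = 7^4 - 7 - 7·(3^4 - 3): of all quadruples, discard those of rank one and those spanning
one of the seven planes. -/
theorem sum_spanning : ∑ t : Fin 7, ∑ r : Fin 7, ∑ q : Fin 7, ∑ p : Fin 7,
    (if spanning p q r t = true then 1 else 0) = 1848 := by
  decide +kernel

theorem card_filter_spanning : (Finset.univ.filter fun b : Fin 4 → Fin 7 =>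
    spanning (b 0) (b 1) (b 2) (b 3) = true).card = 1848 := by
  rw [Finset.card_filter, ← sum_spanning]
  simp only [sum_fin_succ_function, Finset.univ_unique, Finset.sum_singleton]
  rfl

theorem le_statisticsDensity_three_two {n : ℕ} (hn : 3 ≤ n) :
    (8 / 9 : ℝ) ≤ statisticsDensity 3 2 n := by
  -- Nonzero vectors of the plane fail to span only if all are equal: 24 = 3^3 - 3, and likewise 78
  -- = 3^4 - 3 for four vectors.
  have h := le_statisticsDensity_of_vectors (d := 3) (s := 2) (g := 24) (by decide) (by simp)
    planeVector (fun b => ¬ (b 0 = b 1 ∧ b 0 = b 2))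
    (fun b hb => by
      by_cases h1 : b 0 = b 1
      · exact surjective_planeVector b (fun h2 => hb ⟨h1, h2⟩)
      · exact surjective_planeVector b h1) (by decide +kernel) hn
  norm_num at h
  linarith

theorem le_statisticsDensity_four_four {n : ℕ} (hn : 4 ≤ n) :
    (26 / 27 : ℝ) ≤ statisticsDensity 4 4 n := by
  have h := le_statisticsDensity_of_vectors (d := 4) (s := 4) (g := 78) (by decide) (by simp)
    planeVector (fun b => ¬ (b 0 = b 1 ∧ b 0 = b 2 ∧ b 0 = b 3))
    (fun b hb => by
      by_cases h1 : b 0 = b 1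
      · by_cases h2 : b 0 = b 2
        · exact surjective_planeVector b (fun h3 => hb ⟨h1, h2, h3⟩)
        · exact surjective_planeVector b h2
      · exact surjective_planeVector b h1) (by decide +kernel) hn
  norm_num at h
  linarith

theorem le_statisticsDensity_four_two {n : ℕ} (hn : 4 ≤ n) :
    (264 / 343 : ℝ) ≤ statisticsDensity 4 2 n := by
  have h := le_statisticsDensity_of_vectors (d := 4) (s := 2) (g := 1848) (by decide) (by simp)
    spaceVector (fun b => spanning (b 0) (b 1) (b 2) (b 3) = true)
    (fun b hb => by
      simp only [spanning, Bool.or_eq_true] at hb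
      rcases hb with ((h | h) | h) | h <;> exact surjective_spaceVector b h)
    card_filter_spanning.ge hn
  norm_num at h
  linarith

theorem theorem3 :
    IsStatisticsConstant 3 2 (8 / 9) ∧
    IsStatisticsConstant 4 2 (264 / 343) ∧
    IsStatisticsConstant 4 4 (26 / 27) := by
  refine ⟨?_, ?_, ?_⟩
  · exact isStatisticsConstant_of_certificate (m := 1) (A := 54) (B := 48)
      (fun σ => (isPosKernel_formValue _).comp edgeCode) edgePlacements
      injective_of_mem_edgePlacements (by norm_num) (by norm_num) edge_certificate
      fun n hn => le_statisticsDensity_three_two hn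
  · exact isStatisticsConstant_of_certificate (m := 2) (A := 889056) (B := 684288)
      (isPosKernel_squareKernel twoPointForms) squarePlacements
      injective_of_mem_squarePlacements (by norm_num) (by norm_num)
      (square_certificate inRange_twoPointForms cubeCheck_twoPointForms)
      fun n hn => le_statisticsDensity_four_two hn
  · exact isStatisticsConstant_of_certificate (m := 2) (A := 5184) (B := 4992)
      (isPosKernel_squareKernel fourPointForms) squarePlacements
      injective_of_mem_squarePlacements (by norm_num) (by norm_num)
      (square_certificate inRange_fourPointForms cubeCheck_fourPointForms)
      fun n hn => le_statisticsDensity_four_four hn
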